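/- **Model.** Let $n,K,T$ be non-negative integers. For $t=1,\dots,T$ let $\Theta_t\in\{0,1\}^{n\times K}$ be a matrix with exactly one $1$ in each row, let $B_t\in[0,1]^{K\times K}$ be symmetric, and put $P_t=\Theta_tB_t\Theta_t^{\top}$. Let $A_t$ ($t=1,\dots,T$) be random symmetric $n\times n$ real matrices such that the entries $A_t(i,j)$, $1\le t\le T$, $1\le i<j\le n$, are mutually independent and $\{0,1\}$-valued with $\Pr(A_t(i,j)=1)=P_t(i,j)$. The diagonal entries of $A_t$ are arbitrary (for instance a fixed constant). **Estimator.** Let $r\ge 0$ and $l\ge 0$ be integers with $2r\le T$. Put $\mathcal F_{r,1}=\{-r,\dots,r\}$, $\mathcal F_{r,2}=\{0,\dots,r\}$, $\mathcal F_{r,3}=\{-r,\dots,0\}$, and $\mathcal D_{r,1}=\{1+r,\dots,T-r\}$, $\mathcal D_{r,2}=\{1,\dots,r\}$, $\mathcal D_{r,3}=\{T-r+1,\dots,T\}$. Let $W^{(1)},W^{(2)},W^{(3)}:\mathbb Z\to\mathbb R$ satisfy, for $j=1,2,3$, $|W^{(j)}(i)|\le W_{\max}$ for all $i\in\mathcal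 F_{r,j}$ and $$\frac1{|\mathcal F_{r,j}|}\sum_{i\in\mathcal F_{r,j}} i^kW^{(j)}(i)=\begin{cases}1,&k=0,\\0,&k=1,\dots,l.\end{cases}$$ Define $$\hat P_{t,r}=\sum_{j=1}^3\mathbb I(t\in\mathcal D_{r,j})\frac1{|\mathcal F_{r,j}|}\sum_{i\in\mathcal F_{r,j}}W^{(j)}(i)A_{t+i},\qquad P_{t,r}=\sum_{j=1}^3\mathbb I(t\in\mathcal D_{r,j})\frac1{|\mathcal F_{r,j}|}\sum_{i\in\mathcal F_{r,j}}W^{(j)}(i)P_{t+i}.$$ **Claim.** For all $\tau>0$, $c_0>0$, $C_\alpha\ge1$ and $W_{\max}$ there is a constant $C_{0,\tau}>0$, depending only on $\tau,c_0,C_\alpha,W_{\max}$, such that the following holds in every such model. Suppose that the real number $\alpha_n$ satisfies $C_\alpha^{-1}\alpha_n\le\|B_t\|_\infty\le C_\alpha\alpha_n$ for $t=1,\dots,T$ (where $\|\cdot\|_\infty$ is the largest absolute value of an entry) and $\alpha_n\ge C_\alpha^{-1}c_0\log n/n$. Then for every $t\in\{1,\dots,T\}$ there is an event $\Omega_{t,\tau}$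 with $\Pr(\Omega_{t,\tau})\ge1-4n^{-\tau}$ on which $$\bigl\|\operatorname{off}(\hat P_{t,r}-P_{t,r})\bigr\|\le C_{0,\tau}\sqrt{\frac{n\alpha_n}{r\vee1}}$$ and $$\bigl\|\hat P_{t,r}-P_{t,r}\bigr\|\le C_{0,\tau}\sqrt{\frac{n\alpha_n}{r\vee1}}+\max_{1\le i\le n}\bigl|\hat P_{t,r}(i,i)-P_{t,r}(i,i)\bigr| .$$ Here $\|\cdot\|$ is the spectral norm and $\operatorname{off}(M)$ is $M$ with its diagonal entries replaced by $0$. In particular, if $\hat P_{t,r}$ and $P_{t,r}$ have the same diagonal, then on this event $\|\hat P_{t,r}-P_{t,r}\|\le C_{0,\tau}\sqrt{n\alpha_n/(r\vee1)}$. -/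

import Mathlib

open MeasureTheory ProbabilityTheory

noncomputable section

namespace DynSBM

/-- The spectral norm of a square real matrix: its operator norm for the Euclidean norm. -/
def specNorm {n : ℕ} (M : Matrix (Fin n) (Fin n) ℝ) : ℝ :=
  ‖Matrix.toEuclideanCLM (n := Fin n) (𝕜 := ℝ) M‖

/-- The largest absolute value of an entry (the sup norm of the family of entries). -/
def maxAbsEntry {K : ℕ} (M : Matrix (Fin K) (Fin K) ℝ) : ℝ :=
  ‖fun p : Fin K × Fin K => M p.1 p.2‖

/-- The matrix with its diagonal entries replaced by zero. -/
def offDiag {n : ℕ} (M : Matrix (Fin n) (Fin n) ℝ) : Matrix (Fin n) (Fin n) ℝ :=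
  M - Matrix.diagonal (fun i => M i i)

/-- Clustering (membership) matrices: 0/1 entries, exactly one 1 in each row. -/
def IsClusteringMatrix {n K : ℕ} (Θ : Matrix (Fin n) (Fin K) ℝ) : Prop :=
  (∀ i k, Θ i k = 0 ∨ Θ i k = 1) ∧ ∀ i, ∃! k, Θ i k = 1

/-- The edge probability matrices `P_t = Θ_t B_t Θ_tᵀ`. -/
def edgeProb {n K : ℕ} (Θ : ℤ → Matrix (Fin n) (Fin K) ℝ) (B : ℤ → Matrix (Fin K) (Fin K) ℝ)
    (t : ℤ) : Matrix (Fin n) (Fin n) ℝ :=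
  Θ t * B t * (Θ t).transpose

/-- The dynamic stochastic block model at the times `1, …, T`. Only the times in `[1, T]` are
constrained. The diagonal entries of the matrices `A t ω` are left completely arbitrary, so that
any convention for them (a constant such as `10` or `0`, or the corresponding entry of `P_t`)
is covered. -/
structure IsModel {Ω : Type*} [MeasurableSpace Ω] (μ : Measure Ω) (T n K : ℕ)
    (Θ : ℤ → Matrix (Fin n) (Fin K) ℝ) (B : ℤ → Matrix (Fin K) (Fin K) ℝ)
    (A : ℤ → Ω → Matrix (Fin n) (Fin n) ℝ) : Prop where
  clustering : ∀ t ∈ Set.Icc (1 : ℤ) T, IsClusteringMatrix (Θ t)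
  connect_symm : ∀ t ∈ Set.Icc (1 : ℤ) T, (B t).IsSymm
  connect_mem : ∀ t ∈ Set.Icc (1 : ℤ) T, ∀ k k', B t k k' ∈ Set.Icc (0 : ℝ) 1
  adj_symm : ∀ t ∈ Set.Icc (1 : ℤ) T, ∀ ω, (A t ω).IsSymm
  adj_values : ∀ t ∈ Set.Icc (1 : ℤ) T, ∀ i j, i < j → ∀ ω, A t ω i j = 0 ∨ A t ω i j = 1
  adj_measurable : ∀ t ∈ Set.Icc (1 : ℤ) T, ∀ i j, i < j → Measurable fun ω => A t ω i j
  adj_prob : ∀ t ∈ Set.Icc (1 : ℤ) T, ∀ i j, i < j →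
    μ.real {ω | A t ω i j = 1} = edgeProb Θ B t i j
  /-- The edge indicators over all times and all pairs `i < j` are mutually independent. -/
  adj_indep : iIndepFun
    (fun (e : {e : ℤ × Fin n × Fin n // e.1 ∈ Set.Icc (1 : ℤ) T ∧ e.2.1 < e.2.2}) (ω : Ω) =>
      A e.1.1 ω e.1.2.1 e.1.2.2) μ

/-- The windows `{-r, …, r}`, `{0, …, r}`, `{-r, …, 0}` (interior, left and right boundary). -/
def window (r : ℕ) : Fin 3 → Finset ℤ :=
  ![Finset.Icc (-(r : ℤ)) r, Finset.Icc 0 (r : ℤ), Finset.Icc (-(r : ℤ)) 0]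

/-- The time ranges `{1+r, …, T-r}`, `{1, …, r}`, `{T-r+1, …, T}` of the three windows. -/
def timeRange (T r : ℕ) : Fin 3 → Finset ℤ :=
  ![Finset.Icc (1 + r : ℤ) (T - r), Finset.Icc 1 (r : ℤ), Finset.Icc (T - r + 1 : ℤ) T]

/-- Discrete kernels of width `r` and order `l`, bounded by `Wmax`. -/
structure IsKernel (r l : ℕ) (Wmax : ℝ) (W : Fin 3 → ℤ → ℝ) : Prop where
  bound : ∀ j, ∀ i ∈ window r j, |W j i| ≤ Wmax
  moment_zero : ∀ j, (1 / ((window r j).card : ℝ)) * ∑ i ∈ window r j, W j i = 1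
  moment : ∀ j, ∀ k : ℕ, 1 ≤ k → k ≤ l →
    (1 / ((window r j).card : ℝ)) * ∑ i ∈ window r j, (i : ℝ) ^ k * W j i = 0

/-- Kernel smoothing at time `t` of a sequence of matrices: applied to the adjacency matrices it
gives the estimator `P̂_{t,r}`, applied to the edge probability matrices it gives `P_{t,r}`. -/
def smooth {n : ℕ} (T r : ℕ) (W : Fin 3 → ℤ → ℝ) (M : ℤ → Matrix (Fin n) (Fin n) ℝ) (t : ℤ) :
    Matrix (Fin n) (Fin n) ℝ :=
  ∑ j : Fin 3, if t ∈ timeRange T r j then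
    (1 / ((window r j).card : ℝ)) • ∑ i ∈ window r j, W j i • M (t + i) else 0

end DynSBM

end

/-! This is the Kahn–Szemerédi method for sparse random graphs, applied to the superposition of the
`N` graphs in the active window. Off the diagonal the error is `(U + Uᵀ) / N` with `U` strictly
upper triangular, so that no edge indicator is counted twice. Put `q = Cα * α` and `D ^ 2 = N * q *
n`, a bound for the mean degree in the superposition. It suffices that `‖U‖ = O(D)`, because `D / N
= √(q n / N)` and `N ≥ max r 1`. The diagonal costs one triangle inequality.

Independence enters only through `IsPoissonDominated`: the exponential moment of a Bernoulli sum is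
at most that of a Poisson sum. The norm of `U` is read off from its bilinear form on `exp(O(n))`
integer vectors of length at most `4 √n` (`specNorm_le_of_intGrid`).

Light pairs, with `|z i * w j| ≤ 4 D`, have coefficients small enough for a Chernoff bound to
survive the union over the net (`tail_light`). Heavy pairs would not survive it, but they need no
cancellation: the means are small (`heavy_mean_le`), and the random part is bounded
deterministically in `heavy_sum_le` from two properties of the superposition. These are degrees `O(D
^ 2)`, for which `α ≳ log n / n` is needed, and discrepancy: for all `I`, `J`, the edge count
between them, times `1 + log ρ`, is at most `e ρ` times the bound for its mean plus the entropy of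
choosing `I` and `J`. Split by dyadic levels, pairs of very unequal size are handled by the degrees
and the others by discrepancy at `ρ = 2 ^ (s + t) / D`. The sums over levels are geometric, so no
logarithm is lost. -/

namespace DynSBM

open Finset Real

/-! ### Entropy of subsets of a given size -/

/-- The bound `a log (e n / a)` for the logarithm of the number of `a`-subsets of an `n`-set. -/
noncomputable def entropyCost (n a : ℕ) : ℝ := a * (1 + Real.log (n / a))

/-- The cost increases with `a`, so singletons are cheapest. This lets leftover multiples of the
cost absorb powers of `n` in union bounds. -/
lemma entropyCost_ge {n a : ℕ} (ha : 1 ≤ a) (han : a ≤ n) :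
    1 + Real.log n ≤ entropyCost n a := by
  have ha' : (1 : ℝ) ≤ a := by exact_mod_cast ha
  have han' : (a : ℝ) ≤ n := by exact_mod_cast han
  have h0 : (0 : ℝ) < a := by linarith
  have hn : (0 : ℝ) < n := by linarith
  rw [entropyCost, Real.log_div hn.ne' h0.ne']
  have h1 : Real.log a ≤ Real.log n := Real.log_le_log h0 han'
  have h2 : Real.log a ≤ a - 1 := Real.log_le_sub_one_of_pos h0
  nlinarith [mul_le_mul_of_nonneg_left h1 (sub_nonneg.2 ha')]

lemma entropyCost_nonneg {n a : ℕ} (han : a ≤ n) : 0 ≤ entropyCost n a := by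
  rcases Nat.eq_zero_or_pos a with rfl | ha
  · simp [entropyCost]
  · have h := entropyCost_ge ha han
    have : 0 ≤ Real.log (n : ℝ) := Real.log_natCast_nonneg n
    linarith

/-- The binomial coefficient appears in one term of the expansion of `(1 + a / n) ^ n ≤ e ^ a`. -/
lemma choose_le_exp_entropyCost {n a : ℕ} (ha : 1 ≤ a) (han : a ≤ n) :
    (n.choose a : ℝ) ≤ Real.exp (entropyCost n a) := by
  have h0 : (0 : ℝ) < a := by exact_mod_cast ha
  have hn : (0 : ℝ) < n := lt_of_lt_of_le h0 (by exact_mod_cast han)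
  have h1 : ((a : ℝ) / n) ^ a * n.choose a ≤ Real.exp a := by
    calc ((a : ℝ) / n) ^ a * n.choose a
        ≤ ∑ m ∈ range (n + 1), ((a : ℝ) / n) ^ m * 1 ^ (n - m) * n.choose m := by
          have := Finset.single_le_sum
            (f := fun m => ((a : ℝ) / n) ^ m * 1 ^ (n - m) * n.choose m)
            (s := range (n + 1)) (fun m _ => by positivity) (mem_range.2 (Nat.lt_succ_of_le han))
          simpa using this
      _ = ((a : ℝ) / n + 1) ^ n := (add_pow _ _ _).symm
      _ ≤ (Real.exp (a / n)) ^ n := by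
          gcongr
          exact Real.add_one_le_exp _
      _ = Real.exp a := by
          rw [← Real.exp_nat_mul]
          congr 1
          field_simp
  have h2 : Real.exp (entropyCost n a) = Real.exp a * ((n : ℝ) / a) ^ a := by
    rw [entropyCost, mul_add, mul_one, Real.exp_add, Real.exp_nat_mul,
      Real.exp_log (by positivity)]
  have h3 : ((n : ℝ) / a) ^ a * ((a : ℝ) / n) ^ a = 1 := by
    rw [← mul_pow]
    have : (n : ℝ) / a * (a / n) = 1 := by field_simp
    rw [this, one_pow]
  rw [h2]
  calc (n.choose a : ℝ) = ((n : ℝ) / a) ^ a * (((a : ℝ) / n) ^ a * n.choose a) := by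
        rw [← mul_assoc, h3, one_mul]
    _ ≤ ((n : ℝ) / a) ^ a * Real.exp a := by gcongr
    _ = _ := mul_comm _ _

/-- Group the sets by size: one unit of `c` pays for the number of sets of that size, and each of
the `n` sizes keeps `c - 1` units of at least `1 + log n`. -/
lemma sum_exp_neg_entropyCost_le {n : ℕ} {c : ℝ} (hc : 1 ≤ c) :
    ∑ I : Finset (Fin n) with I.Nonempty, Real.exp (-(c * entropyCost n #I)) ≤
      n * Real.exp (-((c - 1) * (1 + Real.log n))) := by
  have h := Finset.sum_powerset_apply_card
    (fun m => if m = 0 then (0 : ℝ) else Real.exp (-(c * entropyCost n m)))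
    (x := (univ : Finset (Fin n)))
  rw [Finset.powerset_univ, Finset.card_univ, Fintype.card_fin] at h
  rw [Finset.sum_filter]
  have e : ∀ I : Finset (Fin n), (if I.Nonempty then Real.exp (-(c * entropyCost n #I)) else 0) =
      if #I = 0 then (0 : ℝ) else Real.exp (-(c * entropyCost n #I)) := by
    intro I
    rcases I.eq_empty_or_nonempty with rfl | hI
    · simp
    · simp [hI, hI.ne_empty]
  rw [Finset.sum_congr rfl fun I _ => e I, h, Finset.sum_range_succ']
  simp only [Nat.add_eq_zero_iff, one_ne_zero, and_false, if_false, if_true, smul_zero, add_zero]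
  calc _ ≤ ∑ m ∈ range n, Real.exp (-((c - 1) * (1 + Real.log n))) := by
        refine Finset.sum_le_sum fun m hm => ?_
        have hm' : m + 1 ≤ n := mem_range.1 hm
        rw [nsmul_eq_mul]
        calc _ ≤ Real.exp (entropyCost n (m + 1)) * Real.exp (-(c * entropyCost n (m + 1))) := by
              gcongr
              exact choose_le_exp_entropyCost (by omega) hm'
          _ ≤ _ := by
              rw [← Real.exp_add]
              apply Real.exp_le_exp.2
              have := mul_le_mul_of_nonneg_left (entropyCost_ge (by omega : 1 ≤ m + 1) hm')
                (sub_nonneg.2 hc)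
              linarith
    _ = _ := by simp

/-- Splitting a factor `8 ^ t` off `n / a` gives `log (n / a) ≤ n / (a * 8 ^ t) + 3 t`. The divisor
`1 + t` cancels the linear term, and both terms that remain sum over `t` to `O(n)` when `a` is the
size of the level set `t`. -/
lemma four_pow_mul_entropyCost_div_le {n a : ℕ} (t : ℕ) :
    (4 : ℝ) ^ t * entropyCost n a / (1 + t) ≤ 4 * (4 ^ t * a) + n * (1 / 2) ^ t := by
  rcases Nat.eq_zero_or_pos a with rfl | ha
  · simp only [entropyCost, Nat.cast_zero, zero_mul, mul_zero, zero_div, zero_add]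
    positivity
  rcases Nat.eq_zero_or_pos n with rfl | hn
  · rw [entropyCost, div_le_iff₀ (by positivity)]
    simp only [Nat.cast_zero, zero_div, Real.log_zero, add_zero, mul_one, zero_mul]
    have : (0 : ℝ) ≤ 4 ^ t * a := by positivity
    nlinarith [mul_nonneg this (Nat.cast_nonneg (α := ℝ) t)]
  have ha' : (0 : ℝ) < a := by exact_mod_cast ha
  have hn' : (0 : ℝ) < n := by exact_mod_cast hn
  have h8 : Real.log 8 ≤ 3 := by
    have : Real.log 8 = 3 * Real.log 2 := by
      rw [show (8 : ℝ) = 2 ^ 3 by norm_num, Real.log_pow]; norm_num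
    have := Real.log_two_lt_d9
    linarith
  have hlog : Real.log (n / a) ≤ n / (a * 8 ^ t) + 3 * t := by
    have e : (n : ℝ) / a = n / (a * 8 ^ t) * 8 ^ t := by field_simp
    rw [e, Real.log_mul (by positivity) (by positivity), Real.log_pow]
    have := Real.log_le_sub_one_of_pos (show (0 : ℝ) < n / (a * 8 ^ t) by positivity)
    nlinarith [mul_le_mul_of_nonneg_left h8 (Nat.cast_nonneg (α := ℝ) t)]
  have hk : (4 : ℝ) ^ t * a * (n / (a * 8 ^ t)) = n * (1 / 2) ^ t := by
    rw [show (8 : ℝ) = 4 * 2 by norm_num, mul_pow, one_div, inv_pow]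
    field_simp
  rw [div_le_iff₀ (by positivity), entropyCost]
  have hA : (0 : ℝ) ≤ 4 ^ t * a := by positivity
  have hB : (0 : ℝ) ≤ n * (1 / 2) ^ t := by positivity
  have ht : (0 : ℝ) ≤ t := Nat.cast_nonneg t
  nlinarith [mul_le_mul_of_nonneg_left hlog hA, mul_nonneg hA ht, mul_nonneg hB ht]

/-! ### Dyadic levels and heavy pairs -/

/-- The dyadic level of a nonzero integer. -/
def level (a : ℤ) : ℕ := Nat.log 2 a.natAbs

lemma two_pow_level_le {a : ℤ} (ha : a ≠ 0) : (2 : ℝ) ^ level a ≤ |(a : ℝ)| := by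
  have := Nat.pow_log_le_self 2 (Int.natAbs_ne_zero.2 ha)
  rw [← Int.cast_abs, Int.abs_eq_natAbs]
  exact_mod_cast this

lemma abs_lt_two_pow_level (a : ℤ) : |(a : ℝ)| ≤ 2 * 2 ^ level a := by
  have := Nat.lt_pow_succ_log_self (b := 2) (by norm_num) a.natAbs
  rw [← Int.cast_abs, Int.abs_eq_natAbs, ← pow_succ']
  exact_mod_cast this.le

/-- Pairs of nonzero integers whose product exceeds the threshold `D`, up to a constant. -/
def IsHeavy (D : ℝ) (a b : ℤ) : Prop := a ≠ 0 ∧ b ≠ 0 ∧ D < 2 ^ (level a + level b)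

lemma IsHeavy.lt_abs_mul {D : ℝ} {a b : ℤ} (h : IsHeavy D a b) :
    D < |(a : ℝ)| * |(b : ℝ)| := by
  refine h.2.2.trans_le ?_
  rw [pow_add]
  exact mul_le_mul (two_pow_level_le h.1) (two_pow_level_le h.2.1) (by positivity) (abs_nonneg _)

lemma abs_mul_le_of_not_isHeavy {D : ℝ} (hD : 0 < D) {a b : ℤ} (h : ¬ IsHeavy D a b) :
    |(a : ℝ)| * |(b : ℝ)| ≤ 4 * D := by
  by_cases ha : a = 0
  · simp [ha, hD.le]
  by_cases hb : b = 0
  · simp [hb, hD.le]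
  have h2 : (2 : ℝ) ^ (level a + level b) ≤ D := by
    by_contra h3
    exact h ⟨ha, hb, not_le.1 h3⟩
  calc |(a : ℝ)| * |(b : ℝ)| ≤ (2 * 2 ^ level a) * (2 * 2 ^ level b) :=
        mul_le_mul (abs_lt_two_pow_level a) (abs_lt_two_pow_level b) (abs_nonneg _) (by positivity)
    _ = 4 * 2 ^ (level a + level b) := by rw [pow_add]; ring
    _ ≤ 4 * D := by linarith

lemma sum_sqrt_two_pow_range_le (m : ℕ) : ∑ s ∈ range (m + 1), √((2 : ℝ) ^ s) ≤ 4 * √(2 ^ m) := by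
  induction m with
  | zero => simp
  | succ m ih =>
    rw [Finset.sum_range_succ, pow_succ, Real.sqrt_mul (by positivity)]
    -- The induction closes when `4 + √2 ≤ 4 √2`, that is `√2 ≥ 4 / 3`.
    have h2 : (4 : ℝ) / 3 ≤ √2 := Real.le_sqrt_of_sq_le (by norm_num)
    nlinarith [Real.sqrt_nonneg ((2 : ℝ) ^ m)]

lemma sum_sqrt_two_pow_le (S : Finset ℕ) {X : ℝ} (hS : ∀ s ∈ S, (2 : ℝ) ^ s ≤ X) :
    ∑ s ∈ S, √((2 : ℝ) ^ s) ≤ 4 * √X := by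
  rcases S.eq_empty_or_nonempty with rfl | hne
  · simp
  calc _ ≤ ∑ s ∈ range (S.max' hne + 1), √((2 : ℝ) ^ s) := by
        refine Finset.sum_le_sum_of_subset_of_nonneg (fun s hs => ?_) fun _ _ _ => Real.sqrt_nonneg _
        exact mem_range.2 (Nat.lt_succ_of_le (S.le_max' s hs))
    _ ≤ 4 * √(2 ^ (S.max' hne)) := sum_sqrt_two_pow_range_le _
    _ ≤ _ := by
        gcongr
        exact hS _ (S.max'_mem hne)

/-- Pairs of levels that are heavy and whose ratio is at most of order `D`. -/
def IsBalanced (D : ℝ) (s t : ℕ) : Prop :=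
  D < 2 ^ (s + t) ∧ (2 : ℝ) ^ s ≤ 2 * D * 2 ^ t ∧ (2 : ℝ) ^ t ≤ 2 * D * 2 ^ s

/-- Since `ρ Q = 2 * 4 ^ t`, the logarithms of `ρ` and `Q` add up to at least `t`, hence `1 + t ≤ (1
+ log ρ) (1 + log Q) ≤ (1 + log ρ) * 2 √Q`. The divisor `1 + log ρ` is thus traded for `1 + t`,
after which `s` survives only in `√(2 ^ s)`, which sums geometrically. -/
lemma two_pow_div_log_le {D : ℝ} (hD : 0 < D) {s t : ℕ} (h : D < 2 ^ (s + t))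
    (h' : (2 : ℝ) ^ s ≤ 2 * D * 2 ^ t) :
    (2 : ℝ) ^ (s + t) / (1 + Real.log (2 ^ (s + t) / D)) ≤
      2 * (2 ^ t * √(2 * D * 2 ^ t) / (1 + t)) * √(2 ^ s) := by
  set ρ : ℝ := 2 ^ (s + t) / D with hρ
  set Q : ℝ := 2 * D * 2 ^ t / 2 ^ s with hQ
  have hρ1 : 1 < ρ := by rw [hρ, lt_div_iff₀ hD]; linarith
  have hQ1 : 1 ≤ Q := by rw [hQ, le_div_iff₀ (by positivity)]; linarith
  have hprod : ρ * Q = 2 * 4 ^ t := by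
    rw [hρ, hQ, pow_add, show (4 : ℝ) = 2 * 2 by norm_num, mul_pow]
    field_simp
  have hlρ : 0 ≤ Real.log ρ := Real.log_nonneg hρ1.le
  have hlQ : 0 ≤ Real.log Q := Real.log_nonneg hQ1
  have h1 : Real.log ρ + Real.log Q = Real.log 2 + t * Real.log 4 := by
    rw [← Real.log_mul (by positivity) (by positivity), hprod,
      Real.log_mul (by positivity) (by positivity), Real.log_pow]
  have hl2 : 0 ≤ Real.log 2 := Real.log_nonneg (by norm_num)
  have hl4 : 1 ≤ Real.log 4 := by
    have : Real.log 4 = 2 * Real.log 2 := by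
      rw [show (4 : ℝ) = 2 ^ 2 by norm_num, Real.log_pow]; norm_num
    have := Real.log_two_gt_d9
    linarith
  have hsq : 1 + Real.log Q ≤ 2 * √Q := by
    have h2 := Real.log_le_sub_one_of_pos (show 0 < √Q by positivity)
    rw [Real.log_sqrt (by positivity)] at h2
    linarith
  have ht : (1 + t : ℝ) ≤ (1 + Real.log ρ) * (2 * √Q) := by
    have : (t : ℝ) ≤ t * Real.log 4 := le_mul_of_one_le_right (Nat.cast_nonneg t) hl4
    nlinarith [mul_nonneg hlρ hlQ, mul_le_mul_of_nonneg_left hsq (by linarith : 0 ≤ 1 + Real.log ρ)]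
  have hsqrt : √(2 * D * 2 ^ t) * √(2 ^ s) = 2 ^ s * √Q := by
    rw [← Real.sqrt_mul (by positivity)]
    have : 2 * D * 2 ^ t * 2 ^ s = (2 ^ s) ^ 2 * Q := by rw [hQ]; field_simp
    rw [this, Real.sqrt_mul (by positivity), Real.sqrt_sq (by positivity)]
  have e : 2 * (2 ^ t * √(2 * D * 2 ^ t) / (1 + t)) * √(2 ^ s) =
      2 ^ (s + t) * (2 * √Q) / (1 + t) := by
    rw [pow_add]
    linear_combination (2 * 2 ^ t / (1 + t : ℝ)) * hsqrt
  rw [e, div_le_div_iff₀ (by positivity) (by positivity)]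
  nlinarith [mul_le_mul_of_nonneg_left ht (show (0 : ℝ) ≤ 2 ^ (s + t) by positivity)]

/-- The indices at which an integer vector is nonzero of dyadic level `s`. -/
def levelSet {n : ℕ} (z : Fin n → ℤ) (s : ℕ) : Finset (Fin n) :=
  {i | z i ≠ 0 ∧ level (z i) = s}

/-- A crude cutoff that makes the level sums finite; the later bounds do not depend on it. -/
lemma level_lt {n : ℕ} {z : Fin n → ℤ} (hz : ∑ i, (z i : ℝ) ^ 2 ≤ 16 * n) {i : Fin n}
    (hi : z i ≠ 0) : level (z i) < 16 * n := by
  have h1 : (z i : ℝ) ^ 2 ≤ 16 * n :=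
    (Finset.single_le_sum (f := fun i => (z i : ℝ) ^ 2) (fun _ _ => sq_nonneg _)
      (mem_univ i)).trans hz
  have h2 := two_pow_level_le hi
  have h3 : (1 : ℝ) ≤ 2 ^ level (z i) := one_le_pow₀ (by norm_num)
  have h4 : (level (z i) : ℝ) < 2 ^ level (z i) := by exact_mod_cast Nat.lt_two_pow_self
  have h5 : |(z i : ℝ)| ^ 2 = (z i : ℝ) ^ 2 := sq_abs _
  have : (level (z i) : ℝ) < 16 * n := by nlinarith
  exact_mod_cast this

lemma sum_four_pow_mul_card_levelSet_le {n : ℕ} (z : Fin n → ℤ) (L : ℕ) :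
    ∑ s ∈ range L, (4 : ℝ) ^ s * #(levelSet z s) ≤ ∑ i, (z i : ℝ) ^ 2 := by
  calc _ = ∑ s ∈ range L, ∑ i : Fin n, if z i ≠ 0 ∧ level (z i) = s then (4 : ℝ) ^ s else 0 := by
        refine Finset.sum_congr rfl fun s _ => ?_
        rw [← Finset.sum_filter, Finset.sum_const, nsmul_eq_mul, mul_comm]
        rfl
    _ = ∑ i : Fin n, ∑ s ∈ range L, if z i ≠ 0 ∧ level (z i) = s then (4 : ℝ) ^ s else 0 :=
        Finset.sum_comm
    _ ≤ _ := by
        refine Finset.sum_le_sum fun i _ => ?_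
        by_cases hi : z i = 0
        · simp [hi]
        have h2 := two_pow_level_le hi
        have h3 : (4 : ℝ) ^ level (z i) ≤ (z i : ℝ) ^ 2 := by
          rw [← sq_abs, show (4 : ℝ) = 2 ^ 2 by norm_num, ← pow_mul, mul_comm, pow_mul]
          gcongr
        simp only [ne_eq, hi, not_false_eq_true, true_and, Finset.sum_ite_eq]
        split_ifs
        · exact h3
        · positivity

/-- If `2 ^ s` ranges over levels that are small compared with `D * 2 ^ t`, the entropy of the
level sets sums to a linear bound. -/
lemma sum_entropyCost_levelSet_le {n : ℕ} {w : Fin n → ℤ} (hw : ∑ i, (w i : ℝ) ^ 2 ≤ 16 * n)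
    {D : ℝ} (hD : 0 < D) (L : ℕ) (P : ℕ → ℕ → Prop) [∀ s t, Decidable (P s t)]
    (hP : ∀ s t, P s t → (2 : ℝ) ^ s ≤ 2 * D * 2 ^ t) :
    ∑ t ∈ range L, ∑ s ∈ range L, (if P s t then
        2 * (2 ^ t * √(2 * D * 2 ^ t) / (1 + t)) * √(2 ^ s) * entropyCost n #(levelSet w t)
      else 0) ≤ 1056 * (n * D) := by
  have hc : ∀ t, #(levelSet w t) ≤ n := fun t => by
    simpa using Finset.card_le_univ (levelSet w t)
  calc _ ≤ ∑ t ∈ range L, 16 * D * (4 * (4 ^ t * (#(levelSet w t) : ℝ)) + n * (1 / 2) ^ t) := by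
        refine Finset.sum_le_sum fun t _ => ?_
        have hH := entropyCost_nonneg (hc t)
        rw [← Finset.sum_filter, ← Finset.sum_mul, ← Finset.mul_sum]
        -- The sum over `s` is dominated by its largest admissible level, `2 ^ s ≤ 2 * D * 2 ^ t`;
        -- the two square roots then multiply to `2 * D * 2 ^ t`.
        have h1 : ∑ s ∈ range L with P s t, √((2 : ℝ) ^ s) ≤ 4 * √(2 * D * 2 ^ t) :=
          sum_sqrt_two_pow_le _ fun s hs => hP s t (mem_filter.1 hs).2
        have hsq : √(2 * D * 2 ^ t) * √(2 * D * 2 ^ t) = 2 * D * 2 ^ t :=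
          Real.mul_self_sqrt (by positivity)
        calc _ ≤ 2 * (2 ^ t * √(2 * D * 2 ^ t) / (1 + t)) * (4 * √(2 * D * 2 ^ t)) *
              entropyCost n #(levelSet w t) := by gcongr
          _ = 16 * D * (4 ^ t * entropyCost n #(levelSet w t) / (1 + t)) := by
              rw [show (4 : ℝ) = 2 * 2 by norm_num, mul_pow]
              linear_combination (8 * 2 ^ t / (1 + t : ℝ) * entropyCost n #(levelSet w t)) * hsq
          _ ≤ _ := by
              gcongr
              exact four_pow_mul_entropyCost_div_le t
    _ = 16 * D * (4 * ∑ t ∈ range L, (4 : ℝ) ^ t * #(levelSet w t) +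
          n * ∑ t ∈ range L, (1 / 2 : ℝ) ^ t) := by
        rw [← Finset.mul_sum, Finset.sum_add_distrib, Finset.mul_sum, Finset.mul_sum]
    _ ≤ 16 * D * (4 * (16 * n) + n * 2) := by
        gcongr
        · exact (sum_four_pow_mul_card_levelSet_le w L).trans hw
        · exact sum_geometric_two_le L
    _ = _ := by ring

/-- At `ρ = 2 ^ (s + t) / D` the mean term of the discrepancy bound separates into a function of `s`
and a function of `t`, each of which sums to a squared norm. -/
lemma four_mul_two_pow_mul {D : ℝ} (hD : 0 < D) (s t : ℕ) (e m a b : ℝ) :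
    4 * 2 ^ (s + t) * (e * (2 ^ (s + t) / D) * (D ^ 2 / m * (a * b))) =
      4 * e * (D / m) * ((4 ^ s * a) * (4 ^ t * b)) := by
  have h4 : ∀ k : ℕ, (4 : ℝ) ^ k = 2 ^ k * 2 ^ k := fun k => by
    rw [← mul_pow]; norm_num
  rw [pow_add, h4 s, h4 t]
  generalize (2 : ℝ) ^ s = u
  generalize (2 : ℝ) ^ t = v
  field_simp

open Classical in
-- Each balanced heavy pair lies in exactly one block of levels, and on it `|z i| * |w j| ≤ 4 * 2 ^
-- (s + t)`.
lemma sum_balanced_le {n : ℕ} {G : Fin n → Fin n → ℝ} (hG : ∀ i j, 0 ≤ G i j) {D : ℝ}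
    {z w : Fin n → ℤ} {L : ℕ} (hzL : ∀ i, z i ≠ 0 → level (z i) < L)
    (hwL : ∀ i, w i ≠ 0 → level (w i) < L) :
    ∑ i, ∑ j, (if IsHeavy D (z i) (w j) ∧ IsBalanced D (level (z i)) (level (w j)) then
      |(z i : ℝ)| * |(w j : ℝ)| * G i j else 0) ≤
      ∑ s ∈ range L, ∑ t ∈ range L, if IsBalanced D s t then
        4 * 2 ^ (s + t) * ∑ i ∈ levelSet z s, ∑ j ∈ levelSet w t, G i j else 0 := by
  have hR : ∀ s t, (if IsBalanced D s t then
      4 * 2 ^ (s + t) * ∑ i ∈ levelSet z s, ∑ j ∈ levelSet w t, G i j else 0) =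
      ∑ i, ∑ j, if (IsBalanced D s t ∧ (z i ≠ 0 ∧ w j ≠ 0)) ∧ level (z i) = s ∧ level (w j) = t
        then 4 * 2 ^ (s + t) * G i j else 0 := by
    intro s t
    by_cases h : IsBalanced D s t
    · simp only [h, if_true, true_and, levelSet, Finset.sum_filter, Finset.mul_sum]
      refine Finset.sum_congr rfl fun i _ => ?_
      by_cases hi : z i ≠ 0 ∧ level (z i) = s
      · rw [if_pos hi, Finset.mul_sum]
        refine Finset.sum_congr rfl fun j _ => ?_
        by_cases hj : w j ≠ 0 ∧ level (w j) = t
        · rw [if_pos hj, if_pos ⟨⟨hi.1, hj.1⟩, hi.2, hj.2⟩]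
        · rw [if_neg hj, if_neg (fun h => hj ⟨h.1.2, h.2.2⟩), mul_zero]
      · rw [if_neg hi, mul_zero]
        symm
        exact Finset.sum_eq_zero fun j _ => if_neg fun h => hi ⟨h.1.1, h.2.1⟩
    · simp [h]
  simp only [hR]
  have hcomm : ∀ F : ℕ → ℕ → Fin n → Fin n → ℝ,
      ∑ s ∈ range L, ∑ t ∈ range L, ∑ i, ∑ j, F s t i j =
      ∑ i, ∑ j, ∑ s ∈ range L, ∑ t ∈ range L, F s t i j := by
    intro F
    calc _ = ∑ s ∈ range L, ∑ i, ∑ t ∈ range L, ∑ j, F s t i j :=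
          Finset.sum_congr rfl fun s _ => Finset.sum_comm
      _ = ∑ s ∈ range L, ∑ i, ∑ j, ∑ t ∈ range L, F s t i j :=
          Finset.sum_congr rfl fun s _ => Finset.sum_congr rfl fun i _ => Finset.sum_comm
      _ = ∑ i, ∑ s ∈ range L, ∑ j, ∑ t ∈ range L, F s t i j := Finset.sum_comm
      _ = _ := Finset.sum_congr rfl fun i _ => Finset.sum_comm
  rw [hcomm]
  refine Finset.sum_le_sum fun i _ => Finset.sum_le_sum fun j _ => ?_
  have hnn : ∀ s t, 0 ≤ (if (IsBalanced D s t ∧ (z i ≠ 0 ∧ w j ≠ 0)) ∧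
      level (z i) = s ∧ level (w j) = t then 4 * 2 ^ (s + t) * G i j else 0) := by
    intro s t
    split_ifs
    · have := hG i j
      positivity
    · exact le_rfl
  split_ifs with h
  · obtain ⟨⟨hi, hj, -⟩, hb⟩ := h
    calc |(z i : ℝ)| * |(w j : ℝ)| * G i j
        ≤ (2 * 2 ^ level (z i)) * (2 * 2 ^ level (w j)) * G i j := by
          have := hG i j
          have := abs_lt_two_pow_level (z i)
          have := abs_lt_two_pow_level (w j)
          gcongr
      _ = (if (IsBalanced D (level (z i)) (level (w j)) ∧ (z i ≠ 0 ∧ w j ≠ 0)) ∧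
            level (z i) = level (z i) ∧ level (w j) = level (w j) then
            4 * 2 ^ (level (z i) + level (w j)) * G i j else 0) := by
          rw [if_pos ⟨⟨hb, hi, hj⟩, rfl, rfl⟩, pow_add]
          ring
      _ ≤ _ := (Finset.single_le_sum (f := fun t =>
            if (IsBalanced D (level (z i)) t ∧ (z i ≠ 0 ∧ w j ≠ 0)) ∧
            level (z i) = level (z i) ∧ level (w j) = t then
            4 * 2 ^ (level (z i) + t) * G i j else 0) (fun t _ => hnn _ t)
            (mem_range.2 (hwL _ hj)))
      _ ≤ _ := (Finset.single_le_sum (f := fun s => ∑ t ∈ range L,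
            if (IsBalanced D s t ∧ (z i ≠ 0 ∧ w j ≠ 0)) ∧
            level (z i) = s ∧ level (w j) = t then
            4 * 2 ^ (s + t) * G i j else 0) (fun s _ => Finset.sum_nonneg fun t _ => hnn s t)
            (mem_range.2 (hzL _ hi)))
  · exact Finset.sum_nonneg fun s _ => Finset.sum_nonneg fun t _ => hnn s t

open Classical in
-- Discrepancy at scale `k = s + t`, divided by `θ = 1 + log ρ`. The mean term just drops `θ ≥ 1`.
-- The entropy of each level set is paired with the version of `two_pow_div_log_le` in which the
-- other level is the one to be summed first.
lemma levelSet_pair_le {n : ℕ} {G : Fin n → Fin n → ℝ} {D c : ℝ}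
    (hD : 0 < D) (hc : 0 ≤ c) {z w : Fin n → ℤ} (hz : ∑ i, (z i : ℝ) ^ 2 ≤ 16 * n)
    (hw : ∑ i, (w i : ℝ) ^ 2 ≤ 16 * n)
    (hdisc : ∀ k : ℕ, D < 2 ^ k → k < 16 * n → ∀ I J : Finset (Fin n), I.Nonempty → J.Nonempty →
      (1 + Real.log (2 ^ k / D)) * ∑ i ∈ I, ∑ j ∈ J, G i j ≤
        Real.exp 1 * (2 ^ k / D) * (D ^ 2 / n * (#I * #J)) +
          c * (entropyCost n #I + entropyCost n #J)) (s t : ℕ) :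
    (if IsBalanced D s t then
    4 * 2 ^ (s + t) * ∑ i ∈ levelSet z s, ∑ j ∈ levelSet w t, G i j else 0) ≤
    4 * Real.exp 1 * (D / n) * ((4 ^ s * #(levelSet z s)) * (4 ^ t * #(levelSet w t))) +
    4 * c * ((if IsBalanced D s t then
      2 * (2 ^ t * √(2 * D * 2 ^ t) / (1 + t)) * √(2 ^ s) * entropyCost n #(levelSet w t)
        else 0) +
      (if IsBalanced D s t then
      2 * (2 ^ s * √(2 * D * 2 ^ s) / (1 + s)) * √(2 ^ t) * entropyCost n #(levelSet z s)
        else 0)) := by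
  have hcard : ∀ (z : Fin n → ℤ) t, #(levelSet z t) ≤ n := fun z t => by
    simpa using Finset.card_le_univ (levelSet z t)
  have hHz := entropyCost_nonneg (hcard z s)
  have hHw := entropyCost_nonneg (hcard w t)
  by_cases h : IsBalanced D s t
  · simp only [h, if_true]
    by_cases hne : (levelSet z s).Nonempty ∧ (levelSet w t).Nonempty
    · obtain ⟨⟨i, hi⟩, ⟨j, hj⟩⟩ := hne
      have hi' := (mem_filter.1 hi).2
      have hj' := (mem_filter.1 hj).2
      -- Witnesses in the two level sets give `2 ^ (s + t) ≤ |z i| * |w j| ≤ 16 n` by the inequality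
      -- of means.
      have hk : s + t < 16 * n := by
        have h1 := two_pow_level_le hi'.1
        have h2 := two_pow_level_le hj'.1
        rw [hi'.2] at h1
        rw [hj'.2] at h2
        have h3 : (z i : ℝ) ^ 2 ≤ 16 * n :=
          (Finset.single_le_sum (f := fun i => (z i : ℝ) ^ 2) (fun _ _ => sq_nonneg _)
            (mem_univ i)).trans hz
        have h4 : (w j : ℝ) ^ 2 ≤ 16 * n :=
          (Finset.single_le_sum (f := fun i => (w i : ℝ) ^ 2) (fun _ _ => sq_nonneg _)
            (mem_univ j)).trans hw
        have h5 : ((s + t : ℕ) : ℝ) < 2 ^ (s + t) := by exact_mod_cast Nat.lt_two_pow_self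
        have h6 : (2 : ℝ) ^ (s + t) ≤ |(z i : ℝ)| * |(w j : ℝ)| := by
          rw [pow_add]; gcongr
        have h7 : |(z i : ℝ)| * |(w j : ℝ)| ≤ 16 * n := by
          nlinarith [sq_nonneg (|(z i : ℝ)| - |(w j : ℝ)|), sq_abs (z i : ℝ), sq_abs (w j : ℝ)]
        have : ((s + t : ℕ) : ℝ) < ((16 * n : ℕ) : ℝ) := by push_cast at *; linarith
        exact_mod_cast this
      have hd := hdisc (s + t) h.1 hk _ _ ⟨i, hi⟩ ⟨j, hj⟩
      have hρ1 : 1 ≤ 2 ^ (s + t) / D := by rw [le_div_iff₀ hD]; linarith [h.1]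
      set θ := 1 + Real.log (2 ^ (s + t) / D) with hθ
      have hθ1 : 1 ≤ θ := by have := Real.log_nonneg hρ1; linarith
      have hθ0 : 0 < θ := by linarith
      set e := ∑ i ∈ levelSet z s, ∑ j ∈ levelSet w t, G i j
      have hT1 := two_pow_div_log_le hD h.1 h.2.1
      have hT2 := two_pow_div_log_le hD (s := t) (t := s) (by rw [add_comm]; exact h.1) h.2.2
      rw [add_comm t s] at hT2
      rw [← hθ] at hT1 hT2
      have hX : 0 ≤ 4 * 2 ^ (s + t) * (Real.exp 1 * (2 ^ (s + t) / D) *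
          (D ^ 2 / n * (#(levelSet z s) * #(levelSet w t)))) := by positivity
      calc 4 * 2 ^ (s + t) * e = 4 * 2 ^ (s + t) * (θ * e) / θ := by field_simp
        _ ≤ 4 * 2 ^ (s + t) * (Real.exp 1 * (2 ^ (s + t) / D) *
              (D ^ 2 / n * (#(levelSet z s) * #(levelSet w t))) +
              c * (entropyCost n #(levelSet z s) + entropyCost n #(levelSet w t))) / θ := by
            gcongr
        _ = 4 * 2 ^ (s + t) * (Real.exp 1 * (2 ^ (s + t) / D) *
              (D ^ 2 / n * (#(levelSet z s) * #(levelSet w t)))) / θ +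
              4 * c * (2 ^ (s + t) / θ * entropyCost n #(levelSet w t) +
                2 ^ (s + t) / θ * entropyCost n #(levelSet z s)) := by ring
        _ ≤ 4 * 2 ^ (s + t) * (Real.exp 1 * (2 ^ (s + t) / D) *
              (D ^ 2 / n * (#(levelSet z s) * #(levelSet w t)))) +
              4 * c * (2 * (2 ^ t * √(2 * D * 2 ^ t) / (1 + t)) * √(2 ^ s) *
                entropyCost n #(levelSet w t) +
                2 * (2 ^ s * √(2 * D * 2 ^ s) / (1 + s)) * √(2 ^ t) *
                entropyCost n #(levelSet z s)) := by
            gcongr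
            exact div_le_self hX hθ1
        _ = _ := by
            rw [four_mul_two_pow_mul hD]
    · have he : ∑ i ∈ levelSet z s, ∑ j ∈ levelSet w t, G i j = 0 := by
        rcases not_and_or.1 hne with h' | h'
        · rw [Finset.not_nonempty_iff_eq_empty.1 h', Finset.sum_empty]
        · rw [Finset.not_nonempty_iff_eq_empty.1 h']
          simp
      rw [he, mul_zero]
      positivity
  · simp only [h, if_false, add_zero, mul_zero]
    positivity

open Classical in
/-- The contribution of the heavy pairs of two integer vectors to the bilinear form of a
nonnegative matrix with bounded row and column sums and the discrepancy property. -/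
theorem heavy_sum_le {n : ℕ} {G : Fin n → Fin n → ℝ} (hG : ∀ i j, 0 ≤ G i j) {D b c : ℝ}
    (hD : 0 < D) (hc : 0 ≤ c) {z w : Fin n → ℤ} (hz : ∑ i, (z i : ℝ) ^ 2 ≤ 16 * n)
    (hw : ∑ i, (w i : ℝ) ^ 2 ≤ 16 * n)
    (hrow : ∀ i, ∑ j, G i j ≤ b * D ^ 2) (hcol : ∀ j, ∑ i, G i j ≤ b * D ^ 2)
    (hdisc : ∀ k : ℕ, D < 2 ^ k → k < 16 * n → ∀ I J : Finset (Fin n), I.Nonempty → J.Nonempty →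
      (1 + Real.log (2 ^ k / D)) * ∑ i ∈ I, ∑ j ∈ J, G i j ≤
        Real.exp 1 * (2 ^ k / D) * (D ^ 2 / n * (#I * #J)) +
          c * (entropyCost n #I + entropyCost n #J)) :
    ∑ i, ∑ j, (if IsHeavy D (z i) (w j) then |(z i : ℝ)| * |(w j : ℝ)| * G i j else 0) ≤
      (32 * b + 1024 * Real.exp 1 + 8448 * c) * (n * D) := by
  rcases Nat.eq_zero_or_pos n with rfl | hn
  · simp
  have hn' : (0 : ℝ) < n := by exact_mod_cast hn
  obtain ⟨L, hL⟩ : ∃ L, L = 16 * n := ⟨_, rfl⟩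
  have hbal := sum_balanced_le (D := D) (z := z) (w := w) (L := L) hG
    (fun i h => hL ▸ level_lt hz h) (fun i h => hL ▸ level_lt hw h)
  have hbal2 : ∑ s ∈ range L, ∑ t ∈ range L, (if IsBalanced D s t then
        4 * 2 ^ (s + t) * ∑ i ∈ levelSet z s, ∑ j ∈ levelSet w t, G i j else 0) ≤
      (1024 * Real.exp 1 + 8448 * c) * (n * D) := by
    refine (Finset.sum_le_sum fun s _ => Finset.sum_le_sum fun t _ => levelSet_pair_le hD hc hz hw hdisc s t).trans ?_
    have hE1 := sum_entropyCost_levelSet_le hw hD L (fun s t => IsBalanced D s t)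
      fun s t h => h.2.1
    have hE2 := sum_entropyCost_levelSet_le hz hD L (fun s t => IsBalanced D t s)
      fun s t h => h.2.2
    rw [Finset.sum_comm] at hE1
    have hz' := (sum_four_pow_mul_card_levelSet_le z L).trans hz
    have hw' := (sum_four_pow_mul_card_levelSet_le w L).trans hw
    have hsplit : ∀ (p q : ℝ) (f g : ℕ → ℝ) (E F : ℕ → ℕ → ℝ),
        ∑ s ∈ range L, ∑ t ∈ range L, (p * (f s * g t) + q * (E s t + F s t)) =
        p * ((∑ s ∈ range L, f s) * ∑ t ∈ range L, g t) +
          q * ((∑ s ∈ range L, ∑ t ∈ range L, E s t) + ∑ s ∈ range L, ∑ t ∈ range L, F s t) := by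
      intro p q f g E F
      rw [Finset.sum_mul_sum]
      simp only [Finset.sum_add_distrib, Finset.mul_sum, mul_add]
    rw [hsplit]
    have h1 : (∑ s ∈ range L, (4 : ℝ) ^ s * #(levelSet z s)) *
        ∑ t ∈ range L, (4 : ℝ) ^ t * #(levelSet w t) ≤ (16 * n) * (16 * n) :=
      mul_le_mul hz' hw' (by positivity) (by positivity)
    refine (add_le_add (mul_le_mul_of_nonneg_left h1 (by positivity))
      (mul_le_mul_of_nonneg_left (add_le_add hE1 hE2) (by positivity))).trans_eq ?_
    field_simp
    ring
  -- Unbalanced pairs: if one factor is at least `D` times the other, the product is at most the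
  -- larger square over `D`, and a row or column sum `b * D ^ 2` leaves `16 * b * n * D`.
  have hu1 : ∑ i, ∑ j, 1 / D * ((z i : ℝ) ^ 2 * G i j) ≤ 16 * b * (n * D) := by
    simp only [← Finset.mul_sum]
    have hb : 0 ≤ b * D ^ 2 := (Finset.sum_nonneg fun j _ => hG ⟨0, hn⟩ j).trans (hrow ⟨0, hn⟩)
    calc _ ≤ 1 / D * ∑ i, (z i : ℝ) ^ 2 * (b * D ^ 2) := by
          gcongr with i
          exact hrow i
      _ ≤ 1 / D * (16 * n * (b * D ^ 2)) := by
          rw [← Finset.sum_mul]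
          gcongr
      _ = _ := by field_simp
  have hu2 : ∑ i, ∑ j, 1 / D * ((w j : ℝ) ^ 2 * G i j) ≤ 16 * b * (n * D) := by
    rw [Finset.sum_comm]
    simp only [← Finset.mul_sum]
    have hb : 0 ≤ b * D ^ 2 := (Finset.sum_nonneg fun j _ => hG ⟨0, hn⟩ j).trans (hrow ⟨0, hn⟩)
    calc _ ≤ 1 / D * ∑ i, (w i : ℝ) ^ 2 * (b * D ^ 2) := by
          gcongr with i
          exact hcol i
      _ ≤ 1 / D * (16 * n * (b * D ^ 2)) := by
          rw [← Finset.sum_mul]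
          gcongr
      _ = _ := by field_simp
  have hpt : ∀ i j, (if IsHeavy D (z i) (w j) then |(z i : ℝ)| * |(w j : ℝ)| * G i j else 0) ≤
      (if IsHeavy D (z i) (w j) ∧ IsBalanced D (level (z i)) (level (w j)) then
        |(z i : ℝ)| * |(w j : ℝ)| * G i j else 0) +
      (1 / D * ((z i : ℝ) ^ 2 * G i j) + 1 / D * ((w j : ℝ) ^ 2 * G i j)) := by
    intro i j
    have hg := hG i j
    have hz0 : 0 ≤ 1 / D * ((z i : ℝ) ^ 2 * G i j) := by positivity
    have hw0 : 0 ≤ 1 / D * ((w j : ℝ) ^ 2 * G i j) := by positivity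
    by_cases h : IsHeavy D (z i) (w j)
    · by_cases hb : IsBalanced D (level (z i)) (level (w j))
      · rw [if_pos h, if_pos ⟨h, hb⟩]
        linarith
      · rw [if_pos h, if_neg (fun h' => hb h'.2), zero_add]
        have hl1 := two_pow_level_le h.1
        have hl2 := abs_lt_two_pow_level (w j)
        have hl3 := two_pow_level_le h.2.1
        have hl4 := abs_lt_two_pow_level (z i)
        -- The factor `2` in `IsBalanced` absorbs the loss in passing from a level to the absolute
        -- value.
        have key : D * |(w j : ℝ)| ≤ |(z i : ℝ)| ∨ D * |(z i : ℝ)| ≤ |(w j : ℝ)| := by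
          by_contra hcon
          rw [not_or, not_le, not_le] at hcon
          refine hb ⟨h.2.2, ?_, ?_⟩
          · nlinarith [hcon.1]
          · nlinarith [hcon.2]
        rcases key with hk | hk
        · have : |(z i : ℝ)| * |(w j : ℝ)| * G i j ≤ 1 / D * ((z i : ℝ) ^ 2 * G i j) := by
            rw [one_div, ← div_eq_inv_mul, le_div_iff₀ hD, ← sq_abs]
            nlinarith [mul_le_mul_of_nonneg_left hk (mul_nonneg (abs_nonneg (z i : ℝ)) hg)]
          linarith
        · have : |(z i : ℝ)| * |(w j : ℝ)| * G i j ≤ 1 / D * ((w j : ℝ) ^ 2 * G i j) := by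
            rw [one_div, ← div_eq_inv_mul, le_div_iff₀ hD, ← sq_abs]
            nlinarith [mul_le_mul_of_nonneg_left hk (mul_nonneg (abs_nonneg (w j : ℝ)) hg)]
          linarith
    · rw [if_neg h, if_neg (fun h' => h h'.1)]
      linarith
  refine (Finset.sum_le_sum fun i _ => Finset.sum_le_sum fun j _ => hpt i j).trans ?_
  simp only [Finset.sum_add_distrib]
  have := hbal.trans hbal2
  linarith

/-! ### A net of integer vectors -/

/-- Integer vectors of Euclidean length at most `4 √n`. -/
noncomputable def intGrid (n : ℕ) : Finset (Fin n → ℤ) :=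
  {z ∈ Fintype.piFinset fun _ => Finset.Icc (-(16 * n : ℤ)) (16 * n) | ∑ i, z i ^ 2 ≤ 16 * n}

lemma mem_intGrid {n : ℕ} {z : Fin n → ℤ} : z ∈ intGrid n ↔ ∑ i, (z i : ℝ) ^ 2 ≤ 16 * n := by
  have e : ∑ i, (z i : ℝ) ^ 2 ≤ 16 * n ↔ ∑ i, z i ^ 2 ≤ 16 * n := by
    rw [← Int.cast_le (R := ℝ)]
    push_cast
    rfl
  rw [e, intGrid, Finset.mem_filter, and_iff_right_iff_imp]
  intro h
  rw [Fintype.mem_piFinset]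
  intro i
  have h1 : z i ^ 2 ≤ 16 * n :=
    (Finset.single_le_sum (f := fun i => z i ^ 2) (fun _ _ => sq_nonneg _) (mem_univ i)).trans h
  rw [Finset.mem_Icc]
  constructor
  · nlinarith [Int.le_self_sq (-z i), neg_sq (z i)]
  · exact (Int.le_self_sq _).trans h1

lemma sum_half_pow_natAbs_le (L : ℕ) :
    ∑ a ∈ Finset.Icc (-(L : ℤ)) L, (1 / 2 : ℝ) ^ a.natAbs ≤ 3 - 2 * (1 / 2) ^ L := by
  induction L with
  | zero => norm_num
  | succ L ih =>
    have h : Finset.Icc (-((L + 1 : ℕ) : ℤ)) ((L + 1 : ℕ) : ℤ) =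
        insert ((L + 1 : ℕ) : ℤ) (insert (-((L + 1 : ℕ) : ℤ)) (Finset.Icc (-(L : ℤ)) L)) := by
      ext a
      simp only [Finset.mem_insert, Finset.mem_Icc]
      omega
    rw [h, Finset.sum_insert, Finset.sum_insert, Int.natAbs_neg, Int.natAbs_natCast, pow_succ]
    · linarith
    · simp only [Finset.mem_Icc]; omega
    · simp only [Finset.mem_insert, Finset.mem_Icc]; omega

/-- For integers `∑ |z i| ≤ ∑ z i ^ 2 ≤ 16 n`, so the weight `2 ^ (16 n) * ∏ 2 ^ (-|z i|)` is at
least one on the grid. Over the enclosing box it factorises, with each coordinate sum below `4`. -/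
lemma card_intGrid_le (n : ℕ) : (#(intGrid n) : ℝ) ≤ Real.exp (18 * n) := by
  calc (#(intGrid n) : ℝ) = ∑ z ∈ intGrid n, (1 : ℝ) := by simp
    _ ≤ ∑ z ∈ intGrid n, (2 : ℝ) ^ (16 * n) * ∏ i, (1 / 2 : ℝ) ^ (z i).natAbs := by
        refine Finset.sum_le_sum fun z hz => ?_
        have hz' : ∑ i, z i ^ 2 ≤ 16 * n := (Finset.mem_filter.1 hz).2
        rw [Finset.prod_pow_eq_pow_sum, one_div, inv_pow, ← div_eq_mul_inv,
          le_div_iff₀ (by positivity), one_mul]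
        refine pow_le_pow_right₀ (by norm_num) ?_
        have : ∑ i, ((z i).natAbs : ℤ) ≤ ∑ i, z i ^ 2 := by
          refine Finset.sum_le_sum fun i _ => ?_
          rw [← Int.natAbs_sq]
          exact Int.le_self_sq _
        have h2 := this.trans hz'
        exact_mod_cast h2
    _ ≤ ∑ z ∈ Fintype.piFinset fun _ : Fin n => Finset.Icc (-((16 * n : ℕ) : ℤ)) ((16 * n : ℕ) : ℤ),
          (2 : ℝ) ^ (16 * n) * ∏ i, (1 / 2 : ℝ) ^ (z i).natAbs := by
        refine Finset.sum_le_sum_of_subset_of_nonneg ?_ fun _ _ _ => by positivity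
        refine (Finset.filter_subset _ _).trans (subset_of_eq ?_)
        push_cast
        rfl
    _ = 2 ^ (16 * n) * (∑ a ∈ Finset.Icc (-((16 * n : ℕ) : ℤ)) ((16 * n : ℕ) : ℤ),
          (1 / 2 : ℝ) ^ a.natAbs) ^ n := by
        rw [← Finset.mul_sum, ← Finset.prod_univ_sum
          (fun _ : Fin n => Finset.Icc (-((16 * n : ℕ) : ℤ)) ((16 * n : ℕ) : ℤ))
          (fun _ a => (1 / 2 : ℝ) ^ a.natAbs), Finset.prod_const, Finset.card_univ,
          Fintype.card_fin]
    _ ≤ 2 ^ (16 * n) * 4 ^ n := by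
        gcongr
        have := sum_half_pow_natAbs_le (16 * n)
        have h0 : (0 : ℝ) ≤ (1 / 2) ^ (16 * n) := by positivity
        linarith
    _ = 2 ^ (18 * n) := by
        rw [show (4 : ℝ) = 2 ^ 2 by norm_num, ← pow_mul, ← pow_add]
        congr 1
        ring
    _ ≤ Real.exp 1 ^ (18 * n) := by
        gcongr
        have := Real.add_one_le_exp 1
        linarith
    _ = _ := by
        rw [← Real.exp_nat_mul]
        push_cast
        ring_nf

/-- Rounding towards zero, so that the rounded vector stays in the ball. -/
lemma exists_int_abs_le (a : ℝ) : ∃ m : ℤ, |(m : ℝ)| ≤ |a| ∧ |a - m| ≤ 1 := by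
  rcases le_total 0 a with h | h
  · refine ⟨⌊a⌋, ?_, ?_⟩
    · rw [abs_of_nonneg h, abs_of_nonneg (by exact_mod_cast Int.floor_nonneg.2 h)]
      exact Int.floor_le a
    · rw [abs_le]
      constructor <;> linarith [Int.floor_le a, Int.lt_floor_add_one a]
  · refine ⟨⌈a⌉, ?_, ?_⟩
    · have : ⌈a⌉ ≤ 0 := Int.ceil_le.2 (by simpa using h)
      rw [abs_of_nonpos h, abs_of_nonpos (by exact_mod_cast this)]
      linarith [Int.le_ceil a]
    · rw [abs_le]
      constructor <;> linarith [Int.le_ceil a, Int.ceil_lt_add_one a]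

/-- Rescaled integer vectors approximate the unit ball up to `1 / 4`. -/
lemma exists_intGrid_approx {n : ℕ} (hn : 0 < n) {x : EuclideanSpace ℝ (Fin n)} (hx : ‖x‖ ≤ 1) :
    ∃ z ∈ intGrid n, ‖WithLp.toLp 2 (fun i => (z i : ℝ) / (4 * √n))‖ ≤ 1 ∧
      ‖x - WithLp.toLp 2 (fun i => (z i : ℝ) / (4 * √n))‖ ≤ 1 / 4 := by
  have hn' : (0 : ℝ) < n := by exact_mod_cast hn
  have hs : 0 < √(n : ℝ) := Real.sqrt_pos.2 hn'
  have hsq : √(n : ℝ) ^ 2 = n := Real.sq_sqrt hn'.le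
  choose z hz1 hz2 using fun i => exists_int_abs_le (4 * √n * x i)
  have hx2 : ∑ i, x i ^ 2 ≤ 1 := by
    rw [← EuclideanSpace.real_norm_sq_eq]
    exact pow_le_one₀ (norm_nonneg _) hx
  have hz : ∑ i, (z i : ℝ) ^ 2 ≤ 16 * n := by
    calc ∑ i, (z i : ℝ) ^ 2 ≤ ∑ i, (16 * n : ℝ) * x i ^ 2 := by
          refine Finset.sum_le_sum fun i _ => ?_
          have := sq_le_sq.2 (hz1 i)
          rw [mul_pow, mul_pow, hsq] at this
          linarith
      _ ≤ (16 * n : ℝ) * 1 := by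
          rw [← Finset.mul_sum]
          gcongr
      _ = _ := mul_one _
  refine ⟨z, mem_intGrid.2 hz, ?_, ?_⟩
  · refine (sq_le_sq₀ (norm_nonneg _) zero_le_one).1 ?_
    rw [one_pow, EuclideanSpace.real_norm_sq_eq]
    simp only [div_pow, mul_pow, hsq]
    rw [← Finset.sum_div, div_le_iff₀ (by positivity)]
    linarith
  · refine (sq_le_sq₀ (norm_nonneg _) (by norm_num)).1 ?_
    rw [EuclideanSpace.real_norm_sq_eq]
    calc _ ≤ ∑ i : Fin n, (1 : ℝ) / (16 * n) := by
          refine Finset.sum_le_sum fun i _ => ?_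
          have e : (x - WithLp.toLp 2 (fun i => (z i : ℝ) / (4 * √n))) i =
              (4 * √n * x i - z i) / (4 * √n) := by
            simp only [PiLp.sub_apply]
            field_simp
          rw [e, div_pow, mul_pow, hsq, ← sq_abs]
          have := pow_le_one₀ (n := 2) (abs_nonneg _) (hz2 i)
          rw [show (4 : ℝ) ^ 2 = 16 by norm_num]
          gcongr
      _ = _ := by
          rw [Finset.sum_const, Finset.card_univ, Fintype.card_fin, nsmul_eq_mul]
          field_simp
          norm_num

/-- The spectral norm is controlled by the bilinear form on integer vectors. -/
theorem specNorm_le_of_intGrid {n : ℕ} (U : Matrix (Fin n) (Fin n) ℝ) {γ : ℝ} (hγ : 0 ≤ γ)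
    (h : ∀ z ∈ intGrid n, ∀ w ∈ intGrid n, |∑ i, ∑ j, (z i : ℝ) * w j * U i j| ≤ γ * n) :
    specNorm U ≤ γ / 8 := by
  rw [specNorm]
  set T := Matrix.toEuclideanCLM (n := Fin n) (𝕜 := ℝ) U with hT
  rcases Nat.eq_zero_or_pos n with rfl | hn
  · have : T = 0 := by
      ext x i
      exact i.elim0
    rw [this, norm_zero]
    positivity
  have hn' : (0 : ℝ) < n := by exact_mod_cast hn
  have hsq : √(n : ℝ) ^ 2 = n := Real.sq_sqrt hn'.le
  have key : ∀ x y : EuclideanSpace ℝ (Fin n), ‖x‖ ≤ 1 → ‖y‖ ≤ 1 →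
      inner ℝ x (T y) ≤ γ / 16 + ‖T‖ / 2 := by
    intro x y hx hy
    obtain ⟨z, hz, hz1, hz2⟩ := exists_intGrid_approx hn hx
    obtain ⟨w, hw, hw1, hw2⟩ := exists_intGrid_approx hn hy
    set x' : EuclideanSpace ℝ (Fin n) := WithLp.toLp 2 (fun i => (z i : ℝ) / (4 * √n)) with hx'
    set y' : EuclideanSpace ℝ (Fin n) := WithLp.toLp 2 (fun i => (w i : ℝ) / (4 * √n)) with hy'
    -- Each of the two rounding errors costs at most `‖T‖ / 4`; together they are half the norm,
    -- absorbed on the left at the end.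
    have e : inner ℝ x (T y) =
        inner ℝ x' (T y') + inner ℝ (x - x') (T y) + inner ℝ x' (T (y - y')) := by
      rw [map_sub, inner_sub_left, inner_sub_right]
      ring
    have e1 : inner ℝ x' (T y') = (∑ i, ∑ j, (z i : ℝ) * w j * U i j) / (16 * n) := by
      rw [hT, hy', Matrix.toEuclideanCLM_toLp, hx', EuclideanSpace.inner_toLp_toLp]
      simp only [dotProduct, Matrix.mulVec, star_trivial, Finset.sum_mul, Finset.sum_div]
      refine Finset.sum_congr rfl fun i _ => Finset.sum_congr rfl fun j _ => ?_
      have : (16 : ℝ) * n = (4 * √n) * (4 * √n) := by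
        linear_combination (-16) * hsq
      rw [this]
      field_simp
    have h1 : inner ℝ x' (T y') ≤ γ / 16 := by
      rw [e1, div_le_iff₀ (by positivity)]
      have := (le_abs_self _).trans (h z hz w hw)
      linarith
    have h2 : inner ℝ (x - x') (T y) ≤ 1 / 4 * (‖T‖ * 1) :=
      (real_inner_le_norm _ _).trans
        (mul_le_mul hz2 (T.le_opNorm_of_le hy) (norm_nonneg _) (by norm_num))
    have h3 : inner ℝ x' (T (y - y')) ≤ 1 * (‖T‖ * (1 / 4)) :=
      (real_inner_le_norm _ _).trans
        (mul_le_mul hz1 (T.le_opNorm_of_le hw2) (norm_nonneg _) (by norm_num))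
    rw [e]
    linarith
  have hN : ‖T‖ ≤ γ / 16 + ‖T‖ / 2 := by
    refine ContinuousLinearMap.opNorm_le_of_unit_norm (by positivity) fun y hy => ?_
    by_cases h0 : T y = 0
    · rw [h0, norm_zero]
      positivity
    · have hpos : 0 < ‖T y‖ := norm_pos_iff.2 h0
      have := key (‖T y‖⁻¹ • T y) y (by rw [norm_smul, norm_inv, norm_norm, inv_mul_cancel₀ hpos.ne'])
        hy.le
      rw [real_inner_smul_left, real_inner_self_eq_norm_sq, sq, ← mul_assoc,
        inv_mul_cancel₀ hpos.ne', one_mul] at this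
      exact this
  linarith

open Classical in
/-- The contribution of the heavy pairs to the means. -/
lemma heavy_mean_le {n : ℕ} {D : ℝ} (hD : 0 < D) {z w : Fin n → ℤ} (hz : z ∈ intGrid n)
    (hw : w ∈ intGrid n) :
    ∑ i, ∑ j, (if IsHeavy D (z i) (w j) then |(z i : ℝ)| * |(w j : ℝ)| * (D ^ 2 / n) else 0) ≤
      256 * (n * D) := by
  rcases Nat.eq_zero_or_pos n with rfl | hn
  · simp
  have hn' : (0 : ℝ) < n := by exact_mod_cast hn
  calc _ ≤ ∑ i, ∑ j, D / n * ((z i : ℝ) ^ 2 * (w j : ℝ) ^ 2) := by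
        refine Finset.sum_le_sum fun i _ => Finset.sum_le_sum fun j _ => ?_
        split_ifs with h
        · have h1 := h.lt_abs_mul
          have h2 : (0 : ℝ) ≤ |(z i : ℝ)| * |(w j : ℝ)| * (D / n) := by positivity
          calc _ = |(z i : ℝ)| * |(w j : ℝ)| * (D / n) * D := by ring
            _ ≤ |(z i : ℝ)| * |(w j : ℝ)| * (D / n) * (|(z i : ℝ)| * |(w j : ℝ)|) := by
                gcongr
            _ = _ := by rw [← sq_abs (z i : ℝ), ← sq_abs (w j : ℝ)]; ring
        · positivity
    _ = D / n * ((∑ i, (z i : ℝ) ^ 2) * ∑ j, (w j : ℝ) ^ 2) := by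
        rw [Finset.sum_mul_sum]
        simp only [Finset.mul_sum]
    _ ≤ D / n * ((16 * n) * (16 * n)) := by
        have := mem_intGrid.1 hz
        have := mem_intGrid.1 hw
        gcongr
    _ = _ := by
        field_simp
        norm_num

/-! ### ### Poisson dominated arrays: tail bounds and the norm bound -/

/-- An array of zero-one variables whose exponential tails are dominated by those of
independent Poisson variables with means `p ≤ q`. -/
structure IsPoissonDominated {Ω κ : Type*} [MeasurableSpace Ω] [Fintype κ] {n : ℕ} (μ : Measure Ω)
    (Y : κ → Fin n → Fin n → Ω → ℝ) (p : κ → Fin n → Fin n → ℝ) (q : ℝ) : Prop where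
  values : ∀ k i j ω, Y k i j ω = 0 ∨ Y k i j ω = 1
  mean_nonneg : ∀ k i j, 0 ≤ p k i j
  mean_le : ∀ k i j, p k i j ≤ q
  tail : ∀ (c : κ → Fin n → Fin n → ℝ) (b : ℝ),
    μ.real {ω | b ≤ ∑ k, ∑ i, ∑ j, c k i j * Y k i j ω} ≤
      Real.exp (-b + ∑ k, ∑ i, ∑ j, p k i j * (Real.exp (c k i j) - 1))

namespace IsPoissonDominated

variable {Ω κ : Type*} [MeasurableSpace Ω] [Fintype κ] {n : ℕ} {μ : Measure Ω}
  {Y : κ → Fin n → Fin n → Ω → ℝ} {p : κ → Fin n → Fin n → ℝ} {q : ℝ}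

lemma nonneg (h : IsPoissonDominated μ Y p q) (k : κ) (i j : Fin n) (ω : Ω) : 0 ≤ Y k i j ω := by
  rcases h.values k i j ω with h | h <;> simp [h]

/-- Tails of centred sums with coefficients bounded by one. -/
lemma tail_centered (h : IsPoissonDominated μ Y p q) {c : κ → Fin n → Fin n → ℝ}
    (hc : ∀ k i j, |c k i j| ≤ 1) (b : ℝ) :
    μ.real {ω | b ≤ ∑ k, ∑ i, ∑ j, c k i j * (Y k i j ω - p k i j)} ≤
      Real.exp (-b + q * ∑ k, ∑ i, ∑ j, c k i j ^ 2) := by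
  have h1 := h.tail c (b + ∑ k, ∑ i, ∑ j, c k i j * p k i j)
  have e : {ω | b ≤ ∑ k, ∑ i, ∑ j, c k i j * (Y k i j ω - p k i j)} =
      {ω | b + ∑ k, ∑ i, ∑ j, c k i j * p k i j ≤ ∑ k, ∑ i, ∑ j, c k i j * Y k i j ω} := by
    ext ω
    simp only [Set.mem_ofPred_eq, mul_sub, Finset.sum_sub_distrib, le_sub_iff_add_le]
  rw [e]
  refine h1.trans (Real.exp_le_exp.2 ?_)
  have h2 : ∑ k, ∑ i, ∑ j, p k i j * (Real.exp (c k i j) - 1) ≤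
      ∑ k, ∑ i, ∑ j, (c k i j * p k i j + q * c k i j ^ 2) := by
    refine Finset.sum_le_sum fun k _ => Finset.sum_le_sum fun i _ => Finset.sum_le_sum fun j _ => ?_
    have h3 := (le_abs_self _).trans (Real.abs_exp_sub_one_sub_id_le (hc k i j))
    have h4 := h.mean_nonneg k i j
    have h5 := h.mean_le k i j
    nlinarith [mul_le_mul_of_nonneg_left h3 h4,
      mul_le_mul_of_nonneg_right h5 (sq_nonneg (c k i j))]
  simp only [Finset.sum_add_distrib, ← Finset.mul_sum] at h2
  linarith

/-- Upper tails of the number of ones in a rectangle. -/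
lemma tail_rectangle (h : IsPoissonDominated μ Y p q) {θ : ℝ} (hθ : 0 ≤ θ) (I J : Finset (Fin n))
    (b : ℝ) :
    μ.real {ω | b ≤ θ * ∑ i ∈ I, ∑ j ∈ J, ∑ k, Y k i j ω} ≤
      Real.exp (-b + Fintype.card κ * q * (#I * #J) * (Real.exp θ - 1)) := by
  have e : ∀ f : κ → Fin n → Fin n → ℝ,
      ∑ k, ∑ i, ∑ j, (if i ∈ I ∧ j ∈ J then f k i j else 0) =
        ∑ i ∈ I, ∑ j ∈ J, ∑ k, f k i j := by
    intro f
    calc _ = ∑ k, ∑ i ∈ I, ∑ j ∈ J, f k i j := by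
          refine Finset.sum_congr rfl fun k _ => ?_
          simp only [ite_and, Finset.sum_ite_irrel, Finset.sum_const_zero, Finset.sum_ite_mem,
            Finset.univ_inter]
      _ = ∑ i ∈ I, ∑ k, ∑ j ∈ J, f k i j := Finset.sum_comm
      _ = _ := Finset.sum_congr rfl fun i _ => Finset.sum_comm
  have h1 := h.tail (fun _ i j => if i ∈ I ∧ j ∈ J then θ else 0) b
  simp only [ite_mul, zero_mul, e] at h1
  have e2 : ∀ k i j, p k i j * (Real.exp (if i ∈ I ∧ j ∈ J then θ else 0) - 1) =
      if i ∈ I ∧ j ∈ J then p k i j * (Real.exp θ - 1) else 0 := by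
    intro k i j
    split_ifs <;> simp
  simp only [e2, e, ← Finset.mul_sum] at h1
  refine h1.trans (Real.exp_le_exp.2 ?_)
  gcongr
  have hθ' : 0 ≤ Real.exp θ - 1 := by linarith [Real.add_one_le_exp θ]
  calc _ ≤ ∑ i ∈ I, ∑ j ∈ J, ∑ k : κ, q * (Real.exp θ - 1) := by
        gcongr with i _ j _ k
        exact h.mean_le k i j
    _ = _ := by
        simp only [Finset.sum_const, nsmul_eq_mul, Finset.card_univ]
        ring

/-- A row is a `1 × n` rectangle whose total mean is at most `D ^ 2`. Tilting by `θ = 1` costs `(e -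
1) D ^ 2 ≤ 2 D ^ 2`, whence `b - 2`. -/
lemma tail_row_sum [IsProbabilityMeasure μ] (h : IsPoissonDominated μ Y p q) {D : ℝ}
    (hD : D ^ 2 = Fintype.card κ * q * n) (b : ℝ) :
    μ.real {ω | ∃ i, b * D ^ 2 < ∑ j, ∑ k, Y k i j ω} ≤ n * Real.exp (-((b - 2) * D ^ 2)) := by
  have hsub : {ω | ∃ i, b * D ^ 2 < ∑ j, ∑ k, Y k i j ω} ⊆
      ⋃ i : Fin n, {ω | b * D ^ 2 ≤ 1 * ∑ i ∈ {i}, ∑ j ∈ univ, ∑ k, Y k i j ω} := by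
    rintro ω ⟨i, hi⟩
    refine Set.mem_iUnion.2 ⟨i, ?_⟩
    simpa using hi.le
  refine (measureReal_mono hsub).trans ((measureReal_iUnion_fintype_le _).trans ?_)
  calc _ ≤ ∑ i : Fin n, Real.exp (-((b - 2) * D ^ 2)) := by
        refine Finset.sum_le_sum fun i _ => ?_
        refine (h.tail_rectangle zero_le_one {i} univ _).trans (Real.exp_le_exp.2 ?_)
        have he : Real.exp 1 - 1 ≤ 2 := by linarith [Real.exp_one_lt_d9]
        simp only [Finset.card_singleton, Nat.cast_one, one_mul, Finset.card_univ,
          Fintype.card_fin, ← hD]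
        nlinarith [mul_le_mul_of_nonneg_left he (sq_nonneg D)]
    _ = _ := by simp

lemma tail_col_sum [IsProbabilityMeasure μ] (h : IsPoissonDominated μ Y p q) {D : ℝ}
    (hD : D ^ 2 = Fintype.card κ * q * n) (b : ℝ) :
    μ.real {ω | ∃ j, b * D ^ 2 < ∑ i, ∑ k, Y k i j ω} ≤ n * Real.exp (-((b - 2) * D ^ 2)) := by
  have hsub : {ω | ∃ j, b * D ^ 2 < ∑ i, ∑ k, Y k i j ω} ⊆
      ⋃ j : Fin n, {ω | b * D ^ 2 ≤ 1 * ∑ i ∈ univ, ∑ j ∈ {j}, ∑ k, Y k i j ω} := by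
    rintro ω ⟨j, hj⟩
    refine Set.mem_iUnion.2 ⟨j, ?_⟩
    simpa using hj.le
  refine (measureReal_mono hsub).trans ((measureReal_iUnion_fintype_le _).trans ?_)
  calc _ ≤ ∑ j : Fin n, Real.exp (-((b - 2) * D ^ 2)) := by
        refine Finset.sum_le_sum fun j _ => ?_
        refine (h.tail_rectangle zero_le_one univ {j} _).trans (Real.exp_le_exp.2 ?_)
        have he : Real.exp 1 - 1 ≤ 2 := by linarith [Real.exp_one_lt_d9]
        simp only [Finset.card_singleton, Nat.cast_one, mul_one, Finset.card_univ,
          Fintype.card_fin, ← hD]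
        nlinarith [mul_le_mul_of_nonneg_left he (sq_nonneg D)]
    _ = _ := by simp

/-- The discrepancy property holds simultaneously for all scales and all rectangles. -/
lemma tail_discrepancy [IsProbabilityMeasure μ] (h : IsPoissonDominated μ Y p q) {D c : ℝ}
    (hn : 0 < n) (hD0 : 0 < D) (hD : D ^ 2 = Fintype.card κ * q * n) (hc : 1 ≤ c) :
    μ.real {ω | ∃ k : ℕ, D < 2 ^ k ∧ k < 16 * n ∧ ∃ I J : Finset (Fin n),
      I.Nonempty ∧ J.Nonempty ∧
      Real.exp 1 * (2 ^ k / D) * (D ^ 2 / n * (#I * #J)) +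
          c * (entropyCost n #I + entropyCost n #J) <
        (1 + Real.log (2 ^ k / D)) * ∑ i ∈ I, ∑ j ∈ J, ∑ k, Y k i j ω} ≤
      16 * n * (n * Real.exp (-((c - 1) * (1 + Real.log n)))) ^ 2 := by
  classical
  have hn' : (0 : ℝ) < n := by exact_mod_cast hn
  set B : ℕ → Finset (Fin n) → Finset (Fin n) → Set Ω := fun k I J =>
    {ω | Real.exp 1 * (2 ^ k / D) * (D ^ 2 / n * (#I * #J)) +
          c * (entropyCost n #I + entropyCost n #J) ≤
        (1 + Real.log (2 ^ k / D)) * ∑ i ∈ I, ∑ j ∈ J, ∑ k, Y k i j ω} with hB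
  have hBle : ∀ k I J, D < 2 ^ k → μ.real (B k I J) ≤
      Real.exp (-(c * entropyCost n #I)) * Real.exp (-(c * entropyCost n #J)) := by
    intro k I J hk
    have hρ1 : 1 ≤ 2 ^ k / D := by rw [le_div_iff₀ hD0]; linarith
    have hlog := Real.log_nonneg hρ1
    refine (h.tail_rectangle (by linarith) I J _).trans ?_
    -- The tilt `θ = 1 + log ρ` has `exp θ = e ρ`, so the mean term in the threshold cancels the
    -- exponential moment and only the entropy costs remain.
    rw [← Real.exp_add, Real.exp_add 1, Real.exp_log (by linarith)]
    refine Real.exp_le_exp.2 ?_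
    have e : Fintype.card κ * q = D ^ 2 / n := by rw [eq_div_iff hn'.ne', hD]
    rw [e]
    have : (0 : ℝ) ≤ D ^ 2 / n * (#I * #J) :=
      mul_nonneg (by positivity) (mul_nonneg (Nat.cast_nonneg _) (Nat.cast_nonneg _))
    nlinarith
  have hsub : {ω | ∃ k : ℕ, D < 2 ^ k ∧ k < 16 * n ∧ ∃ I J : Finset (Fin n),
      I.Nonempty ∧ J.Nonempty ∧
      Real.exp 1 * (2 ^ k / D) * (D ^ 2 / n * (#I * #J)) +
          c * (entropyCost n #I + entropyCost n #J) <
        (1 + Real.log (2 ^ k / D)) * ∑ i ∈ I, ∑ j ∈ J, ∑ k, Y k i j ω} ⊆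
      ⋃ k ∈ (range (16 * n)).filter fun k => D < 2 ^ k,
        ⋃ I ∈ (univ : Finset (Finset (Fin n))).filter Finset.Nonempty,
          ⋃ J ∈ (univ : Finset (Finset (Fin n))).filter Finset.Nonempty, B k I J := by
    rintro ω ⟨k, hk1, hk2, I, J, hI, hJ, hlt⟩
    simp only [Set.mem_iUnion]
    exact ⟨k, Finset.mem_filter.2 ⟨mem_range.2 hk2, hk1⟩, I, by simp [hI], J, by simp [hJ], hlt.le⟩
  refine (measureReal_mono hsub (measure_ne_top _ _)).trans ?_
  calc _ ≤ ∑ k ∈ range (16 * n) with D < 2 ^ k, ∑ I : Finset (Fin n) with I.Nonempty,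
        ∑ J : Finset (Fin n) with J.Nonempty, μ.real (B k I J) := by
        refine (measureReal_biUnion_finset_le _ _).trans (Finset.sum_le_sum fun k _ => ?_)
        refine (measureReal_biUnion_finset_le _ _).trans (Finset.sum_le_sum fun I _ => ?_)
        exact measureReal_biUnion_finset_le _ _
    _ ≤ ∑ k ∈ range (16 * n) with D < 2 ^ k, ∑ I : Finset (Fin n) with I.Nonempty,
        ∑ J : Finset (Fin n) with J.Nonempty,
          Real.exp (-(c * entropyCost n #I)) * Real.exp (-(c * entropyCost n #J)) := by
        refine Finset.sum_le_sum fun k hk => Finset.sum_le_sum fun I _ =>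
          Finset.sum_le_sum fun J _ => hBle k I J (Finset.mem_filter.1 hk).2
    _ = #{k ∈ range (16 * n) | D < 2 ^ k} *
        (∑ I : Finset (Fin n) with I.Nonempty, Real.exp (-(c * entropyCost n #I))) ^ 2 := by
        rw [Finset.sum_const, nsmul_eq_mul, sq, Finset.sum_mul_sum]
    _ ≤ _ := by
        have h1 : (#{k ∈ range (16 * n) | D < 2 ^ k} : ℝ) ≤ 16 * n := by
          have := Finset.card_filter_le (range (16 * n)) fun k => D < 2 ^ k
          rw [Finset.card_range] at this
          exact_mod_cast this
        gcongr
        exact sum_exp_neg_entropyCost_le hc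

open Classical in
/-- Light pairs: the centred bilinear form is uniformly small on the integer net. -/
lemma tail_light [IsProbabilityMeasure μ] (h : IsPoissonDominated μ Y p q) {D V : ℝ}
    (hn : 0 < n) (hD0 : 0 < D) (hD : D ^ 2 = Fintype.card κ * q * n) {W : κ → ℝ} (hV : 0 < V)
    (hW : ∀ k, |W k| ≤ V) (γ : ℝ) :
    μ.real {ω | ∃ z ∈ intGrid n, ∃ w ∈ intGrid n, γ * (n * D) <
      |∑ k, ∑ i, ∑ j, (if IsHeavy D (z i) (w j) then 0 else
        W k * ((z i : ℝ) * w j)) * (Y k i j ω - p k i j)|} ≤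
      2 * Real.exp (52 * n - γ * n / (4 * V)) := by
  have hn' : (0 : ℝ) < n := by exact_mod_cast hn
  set a : (Fin n → ℤ) → (Fin n → ℤ) → κ → Fin n → Fin n → ℝ := fun z w k i j =>
    if IsHeavy D (z i) (w j) then 0 else W k * ((z i : ℝ) * w j) with ha
  set S : (Fin n → ℤ) → (Fin n → ℤ) → Ω → ℝ := fun z w ω =>
    ∑ k, ∑ i, ∑ j, a z w k i j * (Y k i j ω - p k i j) with hS
  have habs : ∀ z w k i j, |a z w k i j| ≤ V * (|(z i : ℝ)| * |(w j : ℝ)|) := by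
    intro z w k i j
    simp only [ha]
    split_ifs
    · rw [abs_zero]; positivity
    · rw [abs_mul, abs_mul]
      gcongr
      exact hW k
  have hle1 : ∀ z w k i j, |a z w k i j| ≤ 4 * V * D := by
    intro z w k i j
    by_cases hh : IsHeavy D (z i) (w j)
    · simp only [ha, hh, if_true, abs_zero]; positivity
    · have := abs_mul_le_of_not_isHeavy hD0 hh
      nlinarith [habs z w k i j]
  have hone : ∀ σ : ℝ, |σ| = 1 → ∀ z ∈ intGrid n, ∀ w ∈ intGrid n,
      μ.real {ω | γ * (n * D) ≤ σ * S z w ω} ≤ Real.exp (16 * n - γ * n / (4 * V)) := by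
    intro σ hσ z hz w hw
    have hσ2 : σ ^ 2 = 1 := by rw [← sq_abs, hσ, one_pow]
    -- Light coefficients are at most `4 * V * D`, so this scaling fits `tail_centered`; the sign
    -- `σ` covers both tails. The variance term is at most `16 n`, and the pairs of grid vectors
    -- contribute `36 n`, which gives the `52 n`.
    have hc : ∀ k i j, |σ / (4 * V * D) * a z w k i j| ≤ 1 := by
      intro k i j
      rw [abs_mul, abs_div, hσ, abs_of_pos (by positivity : 0 < 4 * V * D), one_div,
        ← div_eq_inv_mul, div_le_one (by positivity)]
      exact hle1 z w k i j
    have h1 := h.tail_centered hc (γ * n / (4 * V))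
    have e : {ω | γ * n / (4 * V) ≤ ∑ k, ∑ i, ∑ j, σ / (4 * V * D) * a z w k i j *
        (Y k i j ω - p k i j)} = {ω | γ * (n * D) ≤ σ * S z w ω} := by
      ext ω
      have e1 : ∑ k, ∑ i, ∑ j, σ / (4 * V * D) * a z w k i j * (Y k i j ω - p k i j) =
          σ / (4 * V * D) * S z w ω := by
        simp only [hS, Finset.mul_sum, mul_assoc]
      have e2 : γ * n / (4 * V) = γ * (n * D) / (4 * V * D) := by field_simp
      simp only [Set.mem_ofPred_eq]
      rw [e1, e2, div_mul_eq_mul_div, div_le_div_iff_of_pos_right (by positivity)]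
    rw [e] at h1
    refine h1.trans (Real.exp_le_exp.2 ?_)
    have hq : 0 ≤ q * Fintype.card κ := by
      have : q * Fintype.card κ = D ^ 2 / n := by rw [hD]; field_simp
      rw [this]; positivity
    have hz' := mem_intGrid.1 hz
    have hw' := mem_intGrid.1 hw
    have h2 : q * ∑ k, ∑ i, ∑ j, (σ / (4 * V * D) * a z w k i j) ^ 2 ≤ 16 * n := by
      by_cases hκ : Nonempty κ
      · have hq0 : 0 ≤ q := by
          obtain ⟨k⟩ := hκ
          exact (h.mean_nonneg k ⟨0, hn⟩ ⟨0, hn⟩).trans (h.mean_le k _ _)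
        calc _ ≤ q * ∑ k : κ, ∑ i, ∑ j, 1 / (16 * D ^ 2) * ((z i : ℝ) ^ 2 * (w j : ℝ) ^ 2) := by
              gcongr with k _ i _ j
              rw [mul_pow, div_pow, hσ2, ← sq_abs (a z w k i j)]
              calc _ ≤ 1 / (4 * V * D) ^ 2 * (V * (|(z i : ℝ)| * |(w j : ℝ)|)) ^ 2 := by
                    gcongr
                    exact habs z w k i j
                _ = _ := by
                    rw [mul_pow V, mul_pow |_|, sq_abs, sq_abs]
                    field_simp
                    ring
          _ = q * Fintype.card κ * (1 / (16 * D ^ 2)) *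
              ((∑ i, (z i : ℝ) ^ 2) * ∑ j, (w j : ℝ) ^ 2) := by
              rw [Finset.sum_mul_sum, Finset.sum_const, Finset.card_univ, nsmul_eq_mul]
              simp only [← Finset.mul_sum]
              ring
          _ ≤ q * Fintype.card κ * (1 / (16 * D ^ 2)) * ((16 * n) * (16 * n)) := by
              gcongr
          _ = 16 * n * (Fintype.card κ * q * n / D ^ 2) := by
              field_simp
          _ = _ := by
              rw [← hD, div_self (by positivity), mul_one]
      · rw [not_nonempty_iff] at hκ
        simp
    linarith
  have hsub : {ω | ∃ z ∈ intGrid n, ∃ w ∈ intGrid n, γ * (n * D) < |S z w ω|} ⊆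
      ⋃ z ∈ intGrid n, ⋃ w ∈ intGrid n,
        ({ω | γ * (n * D) ≤ 1 * S z w ω} ∪ {ω | γ * (n * D) ≤ -1 * S z w ω}) := by
    rintro ω ⟨z, hz, w, hw, hlt⟩
    simp only [Set.mem_iUnion]
    refine ⟨z, hz, w, hw, ?_⟩
    rcases lt_abs.1 hlt with h' | h'
    · exact Or.inl (by simpa using h'.le)
    · exact Or.inr (by simpa using h'.le)
  refine (measureReal_mono hsub (measure_ne_top _ _)).trans ?_
  calc _ ≤ ∑ z ∈ intGrid n, ∑ w ∈ intGrid n,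
        (Real.exp (16 * n - γ * n / (4 * V)) + Real.exp (16 * n - γ * n / (4 * V))) := by
        refine (measureReal_biUnion_finset_le _ _).trans (Finset.sum_le_sum fun z hz => ?_)
        refine (measureReal_biUnion_finset_le _ _).trans (Finset.sum_le_sum fun w hw => ?_)
        exact (measureReal_union_le _ _).trans
          (add_le_add (hone 1 (by simp) z hz w hw) (hone (-1) (by simp) z hz w hw))
    _ = 2 * ((#(intGrid n) : ℝ) * #(intGrid n) * Real.exp (16 * n - γ * n / (4 * V))) := by
        simp only [Finset.sum_const, nsmul_eq_mul]
        ring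
    _ ≤ 2 * (Real.exp (18 * n) * Real.exp (18 * n) * Real.exp (16 * n - γ * n / (4 * V))) := by
        gcongr <;> exact card_intGrid_le n
    _ = _ := by
        rw [← Real.exp_add, ← Real.exp_add]
        congr 2
        ring

/-- The constant in the norm bound for centred weighted sums. -/
noncomputable def normConst (τ c₀ V : ℝ) : ℝ :=
  (4 * V * (54 + τ) +
    V * (32 * (2 + (τ + 1) / c₀) + 1024 * Real.exp 1 + 8448 * (τ + 4) + 256)) / 8

open Classical in
/-- A weighted sum of centred arrays has spectral norm of the order of the square root of the
expected degree, outside an event of polynomially small probability. -/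
theorem exists_specNorm_le [IsProbabilityMeasure μ] (h : IsPoissonDominated μ Y p q)
    {D V τ c₀ : ℝ} (hn : 0 < n) (hD0 : 0 < D) (hD : D ^ 2 = Fintype.card κ * q * n)
    {W : κ → ℝ} (hV : 0 < V) (hW : ∀ k, |W k| ≤ V) (hτ : 0 < τ) (hc₀ : 0 < c₀)
    (hlog : c₀ * Real.log n ≤ D ^ 2) :
    ∃ bad : Set Ω, μ.real bad ≤ 4 * (n : ℝ) ^ (-τ) ∧ ∀ ω, ω ∉ bad →
      specNorm (Matrix.of fun i j => ∑ k, W k * (Y k i j ω - p k i j)) ≤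
        normConst τ c₀ V * D := by
  have hn' : (0 : ℝ) < n := by exact_mod_cast hn
  have hn1 : (1 : ℝ) ≤ n := by exact_mod_cast hn
  -- Each constant makes one failure probability at most `n ^ (-τ)`: `b` through `c₀ * log n ≤ D ^
  -- 2` and a union over `n` rows, `c` through the scales and pairs of sets, `γ` by beating the `52
  -- n` of the net.
  set b : ℝ := 2 + (τ + 1) / c₀ with hb
  set c : ℝ := τ + 4 with hc
  set γ : ℝ := 4 * V * (54 + τ) with hγ
  have hpow : (n : ℝ) ^ (-τ) = Real.exp (-(τ * Real.log n)) := by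
    rw [Real.rpow_def_of_pos hn']
    congr 1
    ring
  have hexp : (n : ℝ) = Real.exp (Real.log n) := (Real.exp_log hn').symm
  have hl0 : 0 ≤ Real.log (n : ℝ) := Real.log_nonneg hn1
  have hln : Real.log (n : ℝ) ≤ n := (Real.log_le_sub_one_of_pos hn').trans (by linarith)
  have hdeg : n * Real.exp (-((b - 2) * D ^ 2)) ≤ (n : ℝ) ^ (-τ) := by
    rw [hpow]
    nth_rewrite 1 [hexp]
    rw [← Real.exp_add]
    refine Real.exp_le_exp.2 ?_
    have : (τ + 1) / c₀ * (c₀ * Real.log n) ≤ (τ + 1) / c₀ * D ^ 2 := by gcongr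
    have e : (τ + 1) / c₀ * (c₀ * Real.log n) = (τ + 1) * Real.log n := by field_simp
    have e2 : b - 2 = (τ + 1) / c₀ := by rw [hb]; ring
    rw [e2]
    linarith
  have hdisc : 16 * n * (n * Real.exp (-((c - 1) * (1 + Real.log n)))) ^ 2 ≤ (n : ℝ) ^ (-τ) := by
    have h16 : (16 : ℝ) ≤ Real.exp 6 := by
      calc (16 : ℝ) ≤ 2 ^ 6 := by norm_num
        _ ≤ Real.exp 1 ^ 6 := by
          gcongr
          linarith [Real.add_one_le_exp 1]
        _ = Real.exp 6 := by
          rw [← Real.exp_nat_mul]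
          norm_num
    rw [hpow]
    calc _ ≤ Real.exp 6 * Real.exp (Real.log n) *
          (Real.exp (Real.log n) * Real.exp (-((c - 1) * (1 + Real.log n)))) ^ 2 := by
          rw [← hexp]
          gcongr
      _ = Real.exp (6 + Real.log n + 2 * (Real.log n + -((c - 1) * (1 + Real.log n)))) := by
          rw [← Real.exp_add, ← Real.exp_add, ← Real.exp_nat_mul, ← Real.exp_add]
          norm_num
      _ ≤ _ := by
          refine Real.exp_le_exp.2 ?_
          rw [hc]
          nlinarith [mul_nonneg hτ.le hl0]
  have hlight : 2 * Real.exp (52 * n - γ * n / (4 * V)) ≤ (n : ℝ) ^ (-τ) := by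
    have h2 : (2 : ℝ) ≤ Real.exp 1 := by linarith [Real.add_one_le_exp 1]
    have e : γ * n / (4 * V) = (54 + τ) * n := by rw [hγ]; field_simp
    rw [hpow, e]
    calc _ ≤ Real.exp 1 * Real.exp (52 * n - (54 + τ) * n) := by gcongr
      _ ≤ _ := by
          rw [← Real.exp_add]
          refine Real.exp_le_exp.2 ?_
          nlinarith [mul_le_mul_of_nonneg_left hln hτ.le]
  set B1 : Set Ω := {ω | ∃ i, b * D ^ 2 < ∑ j, ∑ k, Y k i j ω}
  set B2 : Set Ω := {ω | ∃ j, b * D ^ 2 < ∑ i, ∑ k, Y k i j ω}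
  set B3 : Set Ω := {ω | ∃ k : ℕ, D < 2 ^ k ∧ k < 16 * n ∧ ∃ I J : Finset (Fin n),
      I.Nonempty ∧ J.Nonempty ∧
      Real.exp 1 * (2 ^ k / D) * (D ^ 2 / n * (#I * #J)) +
          c * (entropyCost n #I + entropyCost n #J) <
        (1 + Real.log (2 ^ k / D)) * ∑ i ∈ I, ∑ j ∈ J, ∑ k, Y k i j ω}
  set B4 : Set Ω := {ω | ∃ z ∈ intGrid n, ∃ w ∈ intGrid n, γ * (n * D) <
      |∑ k, ∑ i, ∑ j, (if IsHeavy D (z i) (w j) then 0 else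
        W k * ((z i : ℝ) * w j)) * (Y k i j ω - p k i j)|}
  refine ⟨(B1 ∪ B2) ∪ (B3 ∪ B4), ?_, ?_⟩
  · have h1 := (h.tail_row_sum hD b).trans hdeg
    have h2 := (h.tail_col_sum hD b).trans hdeg
    have h3 := (h.tail_discrepancy hn hD0 hD (by linarith : 1 ≤ c)).trans hdisc
    have h4 := (h.tail_light hn hD0 hD hV hW γ).trans hlight
    have h5 := measureReal_union_le (μ := μ) (B1 ∪ B2) (B3 ∪ B4)
    have h6 := measureReal_union_le (μ := μ) B1 B2
    have h7 := measureReal_union_le (μ := μ) B3 B4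
    linarith
  · intro ω hω
    simp only [Set.mem_union, not_or] at hω
    obtain ⟨⟨h1, h2⟩, h3, h4⟩ := hω
    have hrow : ∀ i, ∑ j, ∑ k, Y k i j ω ≤ b * D ^ 2 := fun i =>
      not_lt.1 fun hlt => h1 ⟨i, hlt⟩
    have hcol : ∀ j, ∑ i, ∑ k, Y k i j ω ≤ b * D ^ 2 := fun j =>
      not_lt.1 fun hlt => h2 ⟨j, hlt⟩
    have hdis : ∀ k : ℕ, D < 2 ^ k → k < 16 * n → ∀ I J : Finset (Fin n), I.Nonempty →
        J.Nonempty → (1 + Real.log (2 ^ k / D)) * ∑ i ∈ I, ∑ j ∈ J, ∑ k, Y k i j ω ≤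
        Real.exp 1 * (2 ^ k / D) * (D ^ 2 / n * (#I * #J)) +
          c * (entropyCost n #I + entropyCost n #J) := fun k hk1 hk2 I J hI hJ =>
      not_lt.1 fun hlt => h3 ⟨k, hk1, hk2, I, J, hI, hJ, hlt⟩
    have hG : ∀ i j, 0 ≤ ∑ k, Y k i j ω := fun i j =>
      Finset.sum_nonneg fun k _ => h.nonneg k i j ω
    have hp : ∀ i j, ∑ k, p k i j ≤ D ^ 2 / n := fun i j => by
      calc _ ≤ ∑ k : κ, q := Finset.sum_le_sum fun k _ => h.mean_le k i j
        _ = _ := by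
          rw [Finset.sum_const, nsmul_eq_mul, Finset.card_univ, eq_div_iff hn'.ne', hD]
    have hC : normConst τ c₀ V * D =
        ((γ + V * (32 * b + 1024 * Real.exp 1 + 8448 * c + 256)) * D) / 8 := by
      rw [normConst]
      ring
    have hb0 : 0 < b := by rw [hb]; positivity
    have hc0 : 0 < c := by rw [hc]; positivity
    have hγ0 : 0 < γ := by rw [hγ]; positivity
    rw [hC]
    refine specNorm_le_of_intGrid _ (by positivity) fun z hz w hw => ?_
    have hlz : |∑ k, ∑ i, ∑ j, (if IsHeavy D (z i) (w j) then 0 else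
        W k * ((z i : ℝ) * w j)) * (Y k i j ω - p k i j)| ≤ γ * (n * D) :=
      not_lt.1 fun hlt => h4 ⟨z, hz, w, hw, hlt⟩
    have hcomm : ∑ k, ∑ i, ∑ j, (if IsHeavy D (z i) (w j) then 0 else
        W k * ((z i : ℝ) * w j)) * (Y k i j ω - p k i j) =
        ∑ i, ∑ j, if IsHeavy D (z i) (w j) then 0 else
          (z i : ℝ) * w j * ∑ k, W k * (Y k i j ω - p k i j) := by
      rw [Finset.sum_comm]
      refine Finset.sum_congr rfl fun i _ => ?_
      rw [Finset.sum_comm]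
      refine Finset.sum_congr rfl fun j _ => ?_
      split_ifs
      · simp
      · rw [Finset.mul_sum]
        exact Finset.sum_congr rfl fun k _ => by ring
    rw [hcomm] at hlz
    have hheavy := heavy_sum_le (b := b) hG hD0 hc0.le (mem_intGrid.1 hz) (mem_intGrid.1 hw)
      hrow hcol hdis
    have hmean := heavy_mean_le hD0 hz hw
    -- On heavy pairs cancellation is given up: `|Y - p| ≤ Y + p`.
    have hpt : ∀ i j, |if IsHeavy D (z i) (w j) then
        (z i : ℝ) * w j * ∑ k, W k * (Y k i j ω - p k i j) else 0| ≤
        V * (if IsHeavy D (z i) (w j) then |(z i : ℝ)| * |(w j : ℝ)| * ∑ k, Y k i j ω else 0) +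
        V * (if IsHeavy D (z i) (w j) then |(z i : ℝ)| * |(w j : ℝ)| * (D ^ 2 / n) else 0) := by
      intro i j
      split_ifs
      · have h1 : |∑ k, W k * (Y k i j ω - p k i j)| ≤ V * (∑ k, Y k i j ω + D ^ 2 / n) := by
          calc _ ≤ ∑ k, |W k * (Y k i j ω - p k i j)| := Finset.abs_sum_le_sum_abs _ _
            _ ≤ ∑ k, V * (Y k i j ω + p k i j) := by
                refine Finset.sum_le_sum fun k _ => ?_
                rw [abs_mul]
                have hy := h.nonneg k i j ω
                have hp := h.mean_nonneg k i j
                refine mul_le_mul (hW k) ?_ (abs_nonneg _) hV.le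
                rw [abs_le]
                constructor <;> linarith
            _ ≤ _ := by
                rw [← Finset.mul_sum, Finset.sum_add_distrib]
                have := hp i j
                gcongr
        rw [abs_mul, abs_mul]
        calc _ ≤ |(z i : ℝ)| * |(w j : ℝ)| * (V * (∑ k, Y k i j ω + D ^ 2 / n)) := by gcongr
          _ = _ := by ring
      · simp
    have hsplit : ∑ i, ∑ j, (z i : ℝ) * w j *
        (Matrix.of fun i j => ∑ k, W k * (Y k i j ω - p k i j)) i j =
        (∑ i, ∑ j, if IsHeavy D (z i) (w j) then 0 else
          (z i : ℝ) * w j * ∑ k, W k * (Y k i j ω - p k i j)) +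
        ∑ i, ∑ j, if IsHeavy D (z i) (w j) then
          (z i : ℝ) * w j * ∑ k, W k * (Y k i j ω - p k i j) else 0 := by
      simp only [← Finset.sum_add_distrib]
      refine Finset.sum_congr rfl fun i _ => Finset.sum_congr rfl fun j _ => ?_
      split_ifs <;> simp
    have hH : |∑ i, ∑ j, if IsHeavy D (z i) (w j) then
          (z i : ℝ) * w j * ∑ k, W k * (Y k i j ω - p k i j) else 0| ≤
        V * ((32 * b + 1024 * Real.exp 1 + 8448 * c) * (n * D)) + V * (256 * (n * D)) := by
      refine (Finset.abs_sum_le_sum_abs _ _).trans ?_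
      refine (Finset.sum_le_sum fun i _ => (Finset.abs_sum_le_sum_abs _ _).trans
        (Finset.sum_le_sum fun j _ => hpt i j)).trans ?_
      simp only [Finset.sum_add_distrib, ← Finset.mul_sum]
      exact add_le_add (mul_le_mul_of_nonneg_left hheavy hV.le)
        (mul_le_mul_of_nonneg_left hmean hV.le)
    rw [hsplit]
    refine (abs_add_le _ _).trans ((add_le_add hlz hH).trans_eq ?_)
    ring

end IsPoissonDominated

/-! ### Independent zero-one variables -/

/-- Chernoff's bound with parameter one, the scale being carried by `c`. Independence factorises the
moment, and `1 + x ≤ exp x` replaces each Bernoulli factor by a Poisson one. -/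
lemma measureReal_le_sum_mul_le {Ω ι : Type*} [MeasurableSpace Ω] [Fintype ι] {μ : Measure Ω}
    [IsProbabilityMeasure μ] {X : ι → Ω → ℝ} (hX : iIndepFun X μ)
    (hm : ∀ e, Measurable (X e)) (hv : ∀ e ω, X e ω = 0 ∨ X e ω = 1) (c : ι → ℝ) (b : ℝ) :
    μ.real {ω | b ≤ ∑ e, c e * X e ω} ≤
      Real.exp (-b + ∑ e, μ.real {ω | X e ω = 1} * (Real.exp (c e) - 1)) := by
  have hint : Integrable (fun ω => Real.exp (1 * ∑ e, c e * X e ω)) μ := by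
    refine Integrable.of_bound (by fun_prop) (Real.exp (∑ e, |c e|)) (ae_of_all _ fun ω => ?_)
    rw [Real.norm_eq_abs, Real.abs_exp, one_mul]
    refine Real.exp_le_exp.2 (Finset.sum_le_sum fun e _ => ?_)
    rcases hv e ω with h | h
    · simp [h]
    · simpa [h] using le_abs_self (c e)
  have h1 := measure_ge_le_exp_mul_mgf (X := fun ω => ∑ e, c e * X e ω) b zero_le_one hint
  refine h1.trans ?_
  rw [Real.exp_add, neg_one_mul]
  gcongr
  have hone : ∀ e, ∫ ω, Real.exp (c e * X e ω) ∂μ =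
      1 + μ.real {ω | X e ω = 1} * (Real.exp (c e) - 1) := by
    intro e
    have hms : MeasurableSet {ω | X e ω = 1} := hm e (measurableSet_singleton 1)
    have e1 : ∀ ω, Real.exp (c e * X e ω) =
        1 + {ω | X e ω = 1}.indicator (fun _ => Real.exp (c e) - 1) ω := by
      intro ω
      rcases hv e ω with h | h <;> simp [h]
    simp only [e1]
    rw [integral_add (integrable_const _) ((integrable_const _).indicator hms),
      integral_indicator hms, setIntegral_const]
    simp
  calc mgf (fun ω => ∑ e, c e * X e ω) μ 1 = ∫ ω, ∏ e, Real.exp (c e * X e ω) ∂μ := by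
        simp only [mgf, one_mul, Real.exp_sum]
    _ = ∏ e, ∫ ω, Real.exp (c e * X e ω) ∂μ :=
        hX.integral_fun_prod_comp (f := fun e x => Real.exp (c e * x))
          (fun e => (hm e).aemeasurable)
          (fun e => (by fun_prop : Measurable fun x : ℝ => Real.exp (c e * x)).aestronglyMeasurable)
    _ ≤ ∏ e, Real.exp (μ.real {ω | X e ω = 1} * (Real.exp (c e) - 1)) := by
        refine Finset.prod_le_prod (fun e _ => integral_nonneg fun ω => (Real.exp_pos _).le)
          fun e _ => ?_
        rw [hone, add_comm]
        exact Real.add_one_le_exp _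
    _ = _ := (Real.exp_sum _ _).symm

/-- Independent zero-one variables above the diagonal, extended by zero. -/
lemma IsPoissonDominated.of_iIndepFun {Ω κ : Type*} [MeasurableSpace Ω] [Fintype κ] {n : ℕ}
    {μ : Measure Ω} [IsProbabilityMeasure μ] {X : κ → Fin n → Fin n → Ω → ℝ}
    {P : κ → Fin n → Fin n → ℝ} {q : ℝ} (hq : 0 ≤ q)
    (hX : iIndepFun (fun e : {e : κ × Fin n × Fin n // e.2.1 < e.2.2} =>
      X e.1.1 e.1.2.1 e.1.2.2) μ)
    (hm : ∀ k i j, i < j → Measurable (X k i j))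
    (hv : ∀ k i j, i < j → ∀ ω, X k i j ω = 0 ∨ X k i j ω = 1)
    (hP : ∀ k i j, i < j → μ.real {ω | X k i j ω = 1} = P k i j)
    (hPq : ∀ k i j, i < j → P k i j ≤ q) :
    IsPoissonDominated μ (fun k i j ω => if i < j then X k i j ω else 0)
      (fun k i j => if i < j then P k i j else 0) q where
  values k i j ω := by
    by_cases h : i < j
    · simpa [h] using hv k i j h ω
    · simp [h]
  mean_nonneg k i j := by
    by_cases h : i < j
    · simp only [h, if_true, ← hP k i j h]
      exact measureReal_nonneg
    · simp [h]
  mean_le k i j := by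
    by_cases h : i < j
    · simpa [h] using hPq k i j h
    · simpa [h] using hq
  tail c b := by
    have e : ∀ f : κ → Fin n → Fin n → ℝ,
        ∑ k, ∑ i, ∑ j, (if i < j then f k i j else 0) =
        ∑ e : {e : κ × Fin n × Fin n // e.2.1 < e.2.2}, f e.1.1 e.1.2.1 e.1.2.2 := by
      intro f
      rw [← Finset.sum_subtype ({e | e.2.1 < e.2.2} : Finset (κ × Fin n × Fin n)) (by simp)
        (fun e => f e.1 e.2.1 e.2.2), Finset.sum_filter, Fintype.sum_prod_type]
      simp only [Fintype.sum_prod_type]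
    have h1 := measureReal_le_sum_mul_le hX (fun e => hm _ _ _ e.2) (fun e => hv _ _ _ e.2)
      (fun e => c e.1.1 e.1.2.1 e.1.2.2) b
    have e2 : ∑ e : {e : κ × Fin n × Fin n // e.2.1 < e.2.2},
        μ.real {ω | X e.1.1 e.1.2.1 e.1.2.2 ω = 1} * (Real.exp (c e.1.1 e.1.2.1 e.1.2.2) - 1) =
        ∑ e : {e : κ × Fin n × Fin n // e.2.1 < e.2.2},
          P e.1.1 e.1.2.1 e.1.2.2 * (Real.exp (c e.1.1 e.1.2.1 e.1.2.2) - 1) :=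
      Finset.sum_congr rfl fun e _ => by rw [hP _ _ _ e.2]
    rw [e2] at h1
    simp only [mul_ite, mul_zero, ite_mul, zero_mul, e]
    exact h1

/-! ### The spectral norm -/

lemma specNorm_add_le {n : ℕ} (M N : Matrix (Fin n) (Fin n) ℝ) :
    specNorm (M + N) ≤ specNorm M + specNorm N := by
  rw [specNorm, map_add]
  exact norm_add_le _ _

lemma specNorm_smul {n : ℕ} (a : ℝ) (M : Matrix (Fin n) (Fin n) ℝ) :
    specNorm (a • M) = |a| * specNorm M := by
  rw [specNorm, map_smul, norm_smul, Real.norm_eq_abs, specNorm]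

lemma specNorm_transpose {n : ℕ} (M : Matrix (Fin n) (Fin n) ℝ) :
    specNorm M.transpose = specNorm M := by
  rw [specNorm, ← Matrix.conjTranspose_eq_transpose_of_trivial, ← Matrix.star_eq_conjTranspose,
    map_star, ContinuousLinearMap.star_eq_adjoint, LinearIsometryEquiv.norm_map, specNorm]

open scoped Matrix.Norms.L2Operator in
lemma specNorm_diagonal_le {n : ℕ} (v : Fin n → ℝ) :
    specNorm (Matrix.diagonal v) ≤ ⨆ i, |v i| := by
  have h : specNorm (Matrix.diagonal v) = ‖v‖ := by
    rw [← Matrix.l2_opNorm_diagonal (𝕜 := ℝ) v]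
    rfl
  rw [h, pi_norm_le_iff_of_nonneg (Real.iSup_nonneg fun i => abs_nonneg _)]
  exact fun i => le_ciSup (f := fun i => |v i|) (Set.finite_range _).bddAbove i

lemma specNorm_le_offDiag_add {n : ℕ} (M : Matrix (Fin n) (Fin n) ℝ) :
    specNorm M ≤ specNorm (offDiag M) + ⨆ i, |M i i| := by
  have h := specNorm_add_le (offDiag M) (Matrix.diagonal fun i => M i i)
  rw [offDiag, sub_add_cancel] at h
  exact h.trans (add_le_add le_rfl (specNorm_diagonal_le _))

/-- Off the diagonal, a symmetric matrix is the sum of its strictly upper triangular part and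
the transpose of that part. -/
lemma specNorm_offDiag_le {n : ℕ} {M : Matrix (Fin n) (Fin n) ℝ} (hM : M.IsSymm) :
    specNorm (offDiag M) ≤ 2 * specNorm (Matrix.of fun i j => if i < j then M i j else 0) := by
  set U : Matrix (Fin n) (Fin n) ℝ := Matrix.of fun i j => if i < j then M i j else 0 with hU
  have h : offDiag M = U + U.transpose := by
    ext i j
    simp only [offDiag, hU, Matrix.sub_apply, Matrix.add_apply, Matrix.transpose_apply,
      Matrix.of_apply]
    rcases lt_trichotomy i j with h | rfl | h
    · simp [h, h.ne, h.not_gt]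
    · simp
    · simp [h, h.ne', h.not_gt, hM.apply]
  rw [h]
  refine (specNorm_add_le _ _).trans_eq ?_
  rw [specNorm_transpose]
  ring

/-! ### Edge probabilities and kernel smoothing -/

/-- Rows of a clustering matrix are indicators of one index, so every entry of `P` is an entry of
`B`. -/
lemma edgeProb_le_maxAbsEntry {n K : ℕ} {Θ : ℤ → Matrix (Fin n) (Fin K) ℝ}
    {B : ℤ → Matrix (Fin K) (Fin K) ℝ} {s : ℤ} (h : IsClusteringMatrix (Θ s)) (i j : Fin n) :
    edgeProb Θ B s i j ≤ maxAbsEntry (B s) := by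
  obtain ⟨h01, huniq⟩ := h
  have hrow : ∀ i, ∃ k, ∀ k', Θ s i k' = if k' = k then 1 else 0 := by
    intro i
    obtain ⟨k, hk, hk'⟩ := huniq i
    refine ⟨k, fun k' => ?_⟩
    split_ifs with h
    · rw [h]; exact hk
    · exact (h01 i k').resolve_right fun h1 => h (hk' _ h1)
  obtain ⟨k, hk⟩ := hrow i
  obtain ⟨k', hk'⟩ := hrow j
  have e : edgeProb Θ B s i j = B s k k' := by
    simp [edgeProb, Matrix.mul_apply, Matrix.transpose_apply, hk, hk']
  rw [e]
  exact (le_abs_self _).trans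
    (norm_le_pi_norm (fun p : Fin K × Fin K => B s p.1 p.2) (k, k'))

lemma edgeProb_isSymm {n K : ℕ} {Θ : ℤ → Matrix (Fin n) (Fin K) ℝ}
    {B : ℤ → Matrix (Fin K) (Fin K) ℝ} {s : ℤ} (h : (B s).IsSymm) : (edgeProb Θ B s).IsSymm := by
  rw [Matrix.IsSymm, edgeProb, Matrix.transpose_mul, Matrix.transpose_mul,
    Matrix.transpose_transpose, h.eq, Matrix.mul_assoc]

/-- At each time exactly one of the three windows is active. -/
lemma exists_smooth_eq {T r : ℕ} (hr : 2 * r ≤ T) {t : ℤ} (ht : t ∈ Set.Icc (1 : ℤ) T) :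
    ∃ j : Fin 3, (∀ i ∈ window r j, t + i ∈ Set.Icc (1 : ℤ) T) ∧
      max (r : ℝ) 1 ≤ #(window r j) ∧
      ∀ (n : ℕ) (W : Fin 3 → ℤ → ℝ) (M : ℤ → Matrix (Fin n) (Fin n) ℝ),
        smooth T r W M t =
          (1 / (#(window r j) : ℝ)) • ∑ i ∈ window r j, W j i • M (t + i) := by
  obtain ⟨ht1, ht2⟩ := ht
  have hcard : ∀ m : ℕ, r + 1 ≤ m → max (r : ℝ) 1 ≤ m := by
    intro m hm
    have h1 : (r : ℝ) + 1 ≤ m := by exact_mod_cast hm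
    have h2 : (0 : ℝ) ≤ r := Nat.cast_nonneg r
    exact max_le (by linarith) (by linarith)
  -- The assumption `2 * r ≤ T` keeps the two boundary ranges disjoint and the one-sided windows
  -- inside `[1, T]`. The shortest window has `r + 1` elements.
  rcases lt_or_ge t (1 + r) with h | h
  · have m0 : t ∉ timeRange T r 0 := by simp only [timeRange, Matrix.cons_val, mem_Icc]; omega
    have m1 : t ∈ timeRange T r 1 := by simp only [timeRange, Matrix.cons_val, mem_Icc]; omega
    have m2 : t ∉ timeRange T r 2 := by simp only [timeRange, Matrix.cons_val, mem_Icc]; omega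
    refine ⟨1, fun i hi => ?_, hcard _ ?_, fun n W M => ?_⟩
    · simp only [window, Matrix.cons_val, mem_Icc] at hi
      constructor <;> omega
    · simp only [window, Matrix.cons_val, Int.card_Icc]
      omega
    · simp [smooth, Fin.sum_univ_three, m0, m1, m2]
  rcases le_or_gt t (T - r) with h' | h'
  · have m0 : t ∈ timeRange T r 0 := by simp only [timeRange, Matrix.cons_val, mem_Icc]; omega
    have m1 : t ∉ timeRange T r 1 := by simp only [timeRange, Matrix.cons_val, mem_Icc]; omega
    have m2 : t ∉ timeRange T r 2 := by simp only [timeRange, Matrix.cons_val, mem_Icc]; omega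
    refine ⟨0, fun i hi => ?_, hcard _ ?_, fun n W M => ?_⟩
    · simp only [window, Matrix.cons_val, mem_Icc] at hi
      constructor <;> omega
    · simp only [window, Matrix.cons_val, Int.card_Icc]
      omega
    · simp [smooth, Fin.sum_univ_three, m0, m1, m2]
  · have m0 : t ∉ timeRange T r 0 := by simp only [timeRange, Matrix.cons_val, mem_Icc]; omega
    have m1 : t ∉ timeRange T r 1 := by simp only [timeRange, Matrix.cons_val, mem_Icc]; omega
    have m2 : t ∈ timeRange T r 2 := by simp only [timeRange, Matrix.cons_val, mem_Icc]; omega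
    refine ⟨2, fun i hi => ?_, hcard _ ?_, fun n W M => ?_⟩
    · simp only [window, Matrix.cons_val, mem_Icc] at hi
      constructor <;> omega
    · simp only [window, Matrix.cons_val, Int.card_Icc]
      omega
    · simp [smooth, Fin.sum_univ_three, m0, m1, m2]

/-- Along a window of times, the edge indicators above the diagonal form a Poisson dominated
array. -/
lemma IsModel.isPoissonDominated {Ω : Type*} [MeasurableSpace Ω] {μ : Measure Ω}
    [IsProbabilityMeasure μ] {T n K : ℕ} {Θ : ℤ → Matrix (Fin n) (Fin K) ℝ}
    {B : ℤ → Matrix (Fin K) (Fin K) ℝ} {A : ℤ → Ω → Matrix (Fin n) (Fin n) ℝ}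
    (h : IsModel μ T n K Θ B A) {q : ℝ} (hq : 0 ≤ q)
    (hB : ∀ s ∈ Set.Icc (1 : ℤ) T, maxAbsEntry (B s) ≤ q) {F : Finset ℤ} {t : ℤ}
    (hF : ∀ i ∈ F, t + i ∈ Set.Icc (1 : ℤ) T) :
    IsPoissonDominated μ (fun (k : F) i j ω => if i < j then A (t + k) ω i j else 0)
      (fun (k : F) i j => if i < j then edgeProb Θ B (t + k) i j else 0) q := by
  refine IsPoissonDominated.of_iIndepFun (X := fun (k : F) i j ω => A (t + k) ω i j)
    (P := fun (k : F) i j => edgeProb Θ B (t + k) i j) hq ?_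
    (fun k i j hij => h.adj_measurable _ (hF k k.2) i j hij)
    (fun k i j hij => h.adj_values _ (hF k k.2) i j hij)
    (fun k i j hij => h.adj_prob _ (hF k k.2) i j hij)
    (fun k i j _ => (edgeProb_le_maxAbsEntry (h.clustering _ (hF k k.2)) i j).trans
      (hB _ (hF k k.2)))
  let g : {e : F × Fin n × Fin n // e.2.1 < e.2.2} →
      {e : ℤ × Fin n × Fin n // e.1 ∈ Set.Icc (1 : ℤ) T ∧ e.2.1 < e.2.2} :=
    fun e => ⟨(t + e.1.1, e.1.2), hF _ e.1.1.2, e.2⟩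
  have hg : Function.Injective g := by
    rintro ⟨⟨k, x⟩, hx⟩ ⟨⟨k', x'⟩, hx'⟩ he
    simp only [g, Subtype.mk.injEq, Prod.mk.injEq, add_right_inj] at he
    obtain ⟨h1, rfl⟩ := he
    obtain rfl := Subtype.ext h1
    rfl
  exact h.adj_indep.precomp hg

lemma normConst_pos {τ c₀ V : ℝ} (hτ : 0 < τ) (hc₀ : 0 < c₀) (hV : 0 < V) :
    0 < IsPoissonDominated.normConst τ c₀ V := by
  unfold IsPoissonDominated.normConst
  positivity

/-- The off-diagonal part of the error of kernel smoothing. -/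
theorem exists_offDiag_smooth_le {Ω : Type*} [MeasurableSpace Ω] {μ : Measure Ω}
    [IsProbabilityMeasure μ] {T n K r l : ℕ} {α τ c₀ Cα Wmax : ℝ} (hτ : 0 < τ) (hc₀ : 0 < c₀)
    (hCα : 1 ≤ Cα) {Θ : ℤ → Matrix (Fin n) (Fin K) ℝ} {B : ℤ → Matrix (Fin K) (Fin K) ℝ}
    {A : ℤ → Ω → Matrix (Fin n) (Fin n) ℝ} {W : Fin 3 → ℤ → ℝ} (hn : 2 ≤ n)
    (h : IsModel μ T n K Θ B A)
    (hB : ∀ s ∈ Set.Icc (1 : ℤ) T, maxAbsEntry (B s) ≤ Cα * α) (hW : IsKernel r l Wmax W)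
    (hα : Cα⁻¹ * c₀ * Real.log n / n ≤ α) (hr : 2 * r ≤ T) {t : ℤ}
    (ht : t ∈ Set.Icc (1 : ℤ) T) :
    ∃ bad : Set Ω, μ.real bad ≤ 4 * (n : ℝ) ^ (-τ) ∧ ∀ ω, ω ∉ bad →
      specNorm (offDiag (smooth T r W (fun s => A s ω) t - smooth T r W (edgeProb Θ B) t)) ≤
        2 * IsPoissonDominated.normConst τ c₀ (|Wmax| + 1) * √Cα * √(n * α / max (r : ℝ) 1) := by
  obtain ⟨j, hF, hN, hs⟩ := exists_smooth_eq hr ht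
  set N : ℝ := (#(window r j) : ℝ) with hNdef
  -- A strictly positive kernel bound for any real `Wmax`.
  set V : ℝ := |Wmax| + 1 with hVdef
  set κ := IsPoissonDominated.normConst τ c₀ V with hκ
  have hV : 0 < V := by positivity
  have hκ0 : 0 < κ := normConst_pos hτ hc₀ hV
  have hm1 : (1 : ℝ) ≤ max (r : ℝ) 1 := le_max_right _ _
  have hm0 : (0 : ℝ) < max (r : ℝ) 1 := by linarith
  have hN1 : 1 ≤ N := hm1.trans hN
  have hN0 : 0 < N := by linarith
  have hn1 : (1 : ℝ) < n := by exact_mod_cast (by omega : 1 < n)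
  have hn0 : (0 : ℝ) < n := by linarith
  have hlog : 0 < Real.log n := Real.log_pos hn1
  have hC0 : 0 < Cα := by linarith
  have hα0 : 0 < α := lt_of_lt_of_le (by positivity) hα
  set D : ℝ := √(N * (Cα * α) * n) with hD
  have hDsq : D ^ 2 = N * (Cα * α) * n := Real.sq_sqrt (by positivity)
  have hD0 : 0 < D := Real.sqrt_pos.2 (by positivity)
  have hdeg : c₀ * Real.log n ≤ D ^ 2 := by
    rw [div_le_iff₀ hn0] at hα
    have h1 : c₀ * Real.log n ≤ Cα * (α * n) := by
      calc c₀ * Real.log n = Cα * (Cα⁻¹ * c₀ * Real.log n) := by field_simp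
        _ ≤ _ := by gcongr
    rw [hDsq]
    have : 0 ≤ Cα * (α * n) := by positivity
    nlinarith
  have hdom := h.isPoissonDominated (q := Cα * α) (by positivity) hB hF
  obtain ⟨bad, hbad, hgood⟩ := hdom.exists_specNorm_le (D := D) (V := V)
    (W := fun k => W j k) (by omega : 0 < n) hD0
    (by rw [hDsq, Fintype.card_coe]) hV
    (fun k => (hW.bound j k k.2).trans ((le_abs_self _).trans (by linarith))) hτ hc₀ hdeg
  refine ⟨bad, hbad, fun ω hω => ?_⟩
  have hU := hgood ω hω
  rw [hs, hs, ← smul_sub, ← Finset.sum_sub_distrib]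
  simp only [← smul_sub]
  set S : Matrix (Fin n) (Fin n) ℝ :=
    ∑ i ∈ window r j, W j i • (A (t + i) ω - edgeProb Θ B (t + i)) with hS
  have hSsymm : S.IsSymm := by
    rw [hS, Matrix.IsSymm, Matrix.transpose_sum]
    refine Finset.sum_congr rfl fun i hi => ?_
    rw [Matrix.transpose_smul, Matrix.transpose_sub, (h.adj_symm _ (hF i hi) ω).eq,
      (edgeProb_isSymm (h.connect_symm _ (hF i hi))).eq]
  have hoff : offDiag ((1 / N) • S) = (1 / N) • offDiag S := by
    ext i k
    by_cases hik : i = k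
    · simp [offDiag, hik]
    · simp [offDiag, hik]
  have hupper : (Matrix.of fun i k => if i < k then S i k else 0) =
      Matrix.of fun i k => ∑ x : window r j, W j x *
        ((if i < k then A (t + x) ω i k else 0) - if i < k then edgeProb Θ B (t + x) i k else 0) := by
    ext i k
    simp only [Matrix.of_apply]
    split_ifs
    · rw [hS, Matrix.sum_apply, ← Finset.sum_coe_sort]
      rfl
    · simp
  rw [hoff, specNorm_smul, abs_of_pos (by positivity)]
  have h2 := specNorm_offDiag_le hSsymm
  rw [hupper] at h2
  -- Averaging over `N` times turns `D = √(N * q * n)` into `√(q * n / N)`; this is the gain from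
  -- smoothing.
  have hDN : 1 / N * D ≤ √Cα * √(n * α / max (r : ℝ) 1) := by
    rw [← Real.sqrt_mul hC0.le]
    refine Real.le_sqrt_of_sq_le ?_
    rw [mul_pow, hDsq]
    calc (1 / N) ^ 2 * (N * (Cα * α) * n) = Cα * (n * α / N) := by field_simp
      _ ≤ _ := by gcongr
  calc 1 / N * specNorm (offDiag S) ≤ 1 / N * (2 * (κ * D)) := by
        gcongr
        linarith
    _ = 2 * κ * (1 / N * D) := by ring
    _ ≤ 2 * κ * (√Cα * √(n * α / max (r : ℝ) 1)) := by gcongr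
    _ = _ := by ring

end DynSBM

/-! ### ### The main estimate -/

theorem lemma2 (τ c₀ Cα Wmax : ℝ) (hτ : 0 < τ) (hc₀ : 0 < c₀) (hCα : 1 ≤ Cα) :
    ∃ C : ℝ, 0 < C ∧
      ∀ (Ω : Type*) [MeasurableSpace Ω] (μ : Measure Ω) [IsProbabilityMeasure μ]
        (T n K r l : ℕ) (α : ℝ)
        (Θ : ℤ → Matrix (Fin n) (Fin K) ℝ) (B : ℤ → Matrix (Fin K) (Fin K) ℝ)
        (A : ℤ → Ω → Matrix (Fin n) (Fin n) ℝ) (W : Fin 3 → ℤ → ℝ),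
        DynSBM.IsModel μ T n K Θ B A →
        (∀ s ∈ Set.Icc (1 : ℤ) T,
          Cα⁻¹ * α ≤ DynSBM.maxAbsEntry (B s) ∧ DynSBM.maxAbsEntry (B s) ≤ Cα * α) →
        DynSBM.IsKernel r l Wmax W →
        Cα⁻¹ * c₀ * Real.log n / n ≤ α →
        2 * r ≤ T →
        ∀ t ∈ Set.Icc (1 : ℤ) T,
          ∃ S : Set Ω, MeasurableSet S ∧ 1 - 4 * (n : ℝ) ^ (-τ) ≤ μ.real S ∧
            ∀ ω ∈ S,
              DynSBM.specNorm (DynSBM.offDiag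
                  (DynSBM.smooth T r W (fun s => A s ω) t -
                    DynSBM.smooth T r W (DynSBM.edgeProb Θ B) t)) ≤
                C * √(n * α / max (r : ℝ) 1) ∧
              DynSBM.specNorm
                  (DynSBM.smooth T r W (fun s => A s ω) t -
                    DynSBM.smooth T r W (DynSBM.edgeProb Θ B) t) ≤
                C * √(n * α / max (r : ℝ) 1) +
                  ⨆ i : Fin n, |(DynSBM.smooth T r W (fun s => A s ω) t -
                    DynSBM.smooth T r W (DynSBM.edgeProb Θ B) t) i i| := by
  have hκ : 0 < DynSBM.IsPoissonDominated.normConst τ c₀ (|Wmax| + 1) :=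
    DynSBM.normConst_pos hτ hc₀ (by positivity)
  refine ⟨2 * DynSBM.IsPoissonDominated.normConst τ c₀ (|Wmax| + 1) * √Cα, by positivity, ?_⟩
  intro Ω _ μ _ T n K r l α Θ B A W hmodel hB hW hα hr t ht
  obtain ⟨bad, hbad, hgood⟩ : ∃ bad : Set Ω, μ.real bad ≤ 4 * (n : ℝ) ^ (-τ) ∧ ∀ ω, ω ∉ bad →
      DynSBM.specNorm (DynSBM.offDiag (DynSBM.smooth T r W (fun s => A s ω) t -
        DynSBM.smooth T r W (DynSBM.edgeProb Θ B) t)) ≤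
        2 * DynSBM.IsPoissonDominated.normConst τ c₀ (|Wmax| + 1) * √Cα *
          √(n * α / max (r : ℝ) 1) := by
    -- For `n ≤ 1` there is nothing off the diagonal, and `log n = 0` would not force `α > 0`. The
    -- empty bad set also suits `n = 0`, where `(0 : ℝ) ^ (-τ) = 0` demands full probability.
    rcases Nat.lt_or_ge n 2 with hn | hn
    · refine ⟨∅, by rw [measureReal_empty]; positivity, fun ω _ => ?_⟩
      have h0 : ∀ M : Matrix (Fin n) (Fin n) ℝ, DynSBM.offDiag M = 0 := by
        intro M
        ext i j
        have : i = j := Fin.ext (by omega)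
        simp [DynSBM.offDiag, this]
      rw [h0, DynSBM.specNorm, map_zero, norm_zero]
      positivity
    · exact DynSBM.exists_offDiag_smooth_le hτ hc₀ hCα hn hmodel (fun s hs => (hB s hs).2) hW hα
        hr ht
  -- The bad set comes without a measurability proof; its measurable hull has the same measure.
  refine ⟨(toMeasurable μ bad)ᶜ, (measurableSet_toMeasurable μ bad).compl, ?_, fun ω hω => ?_⟩
  · rw [probReal_compl_eq_one_sub (measurableSet_toMeasurable μ bad), measureReal_def,
      measure_toMeasurable, ← measureReal_def]
    linarith
  · have h1 := hgood ω fun h => hω (subset_toMeasurable μ bad h)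
    exact ⟨h1, (DynSBM.specNorm_le_offDiag_add _).trans (add_le_add h1 le_rfl)⟩
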